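/- Let $G$ be a connected Lie group of dimension $n$ with Lie algebra $\mathfrak g$, acting smoothly on a (Hausdorff, finite-dimensional, smooth) symplectic manifold $(M,\omega)$ by symplectomorphisms, with a smooth moment map $\mu:M\to\mathfrak g^*$, i.e. $d\langle\mu,X\rangle=\iota_{X_M}\omega$ for all $X\in\mathfrak g$, where $X_M(p)=\frac{d}{ds}\big|_{s=0}\exp(sX)\cdot p$, and $\mu(g\cdot p)=\mathrm{Ad}^*_g\,\mu(p)$. Let $\pi$ be the Poisson structure induced by $\omega$, i.e. $\pi(\iota_v\omega,\beta)=\beta(v)$, and for $t\in\Lambda^2\mathfrak g$ let $t_M$ be the fundamental $2$-vector field of $t$ (the image of $t$ under $X\mapsto X_M$). Let $T^*G\cong G\times\mathfrak g^*$ be the semidirect product group with respect to the coadjoint action, $(g,\alpha)(h,\beta)=(gh,\alpha+\mathrm{Ad}^*_g\beta)$, let $\mathfrak d=\mathfrak g\oplus\mathfrak g^*$ with the scalar product $(X+\xi\,|\,Y+\eta)=\xi(Y)+\eta(X)$, and identify $T^*G/G$ with $\mathfrak g^*$, on which $T^*G$ acts by the dressing action $(g,\alpha)\cdot\eta=\alpha+\mathrm{Ad}^*_g\eta$.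 For $t\in\Lambda^2\mathfrak g$ put $\mathfrak g^*_t=\{\xi+t^\sharp\xi\mid\xi\in\mathfrak g^*\}\subset\mathfrak d$, where $\langle\eta,t^\sharp\xi\rangle=t(\xi,\eta)$. For $t\in\Lambda^2\mathfrak g$ consider the following assertions. (a) $[t,t]=0$ in $\Lambda^3\mathfrak g$ (Schouten bracket). (b) $\mathfrak g^*_t$ is an isotropic complement of $\mathfrak g$ in $\mathfrak d$ and is admissible at every point $\eta\in\mathfrak g^*$, i.e. the infinitesimal dressing action $\mathfrak g^*_t\to T_\eta\mathfrak g^*$ is an isomorphism; that is, the quasi-triple $(T^*G,G,\mathfrak g^*_t)$ is complete. (c) $t$ deforms $\omega$ to a symplectic form $\omega_t$: the $2$-vector field $\pi-t_M$ is a nondegenerate Poisson structure on $M$, and there is a unique symplectic form $\omega_t$ on $M$ whose induced Poisson structure is $\pi-t_M$. Then: 1. If $X,Y\in\mathfrak g$ satisfy $[X,Y]=0$, then (a), (b), (c) hold for $t=\frac12X\wedge Y$. 2. Let $\mathfrak h$ be a Cartan subalgebra (nilpotent and self-normalizing) of $\mathfrak g$. If $\mathfrak g$ is reductive (the direct sum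 of its centre and a semisimple ideal), then $\mathfrak h$ is abelian. Whenever $\mathfrak h$ is abelian, (a), (b), (c) hold for every $t\in\Lambda^2\mathfrak h$. -/

import Mathlib

open scoped Manifold ContDiff

noncomputable section

namespace SympTwist

/-! ### Bivectors and the Schouten bracket on a Lie algebra -/

section Algebra

variable {V : Type*} [AddCommGroup V] [Module ℝ V]

/-- The exterior product `v ∧ w` in `Λ² V`. -/
def wedge₂ (v w : V) : ⋀[ℝ]^2 V := exteriorPower.ιMulti ℝ 2 ![v, w]

/-- The exterior product `u ∧ v ∧ w` in `Λ³ V`. -/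
def wedge₃ (u v w : V) : ⋀[ℝ]^3 V := exteriorPower.ιMulti ℝ 3 ![u, v, w]

/-- The value `t(α, β)` of a bivector `t ∈ Λ² V` on two covectors, normalised by
`(v ∧ w)(α, β) = α v * β w - α w * β v`. -/
def bivectorEval (t : ⋀[ℝ]^2 V) (α β : Module.Dual ℝ V) : ℝ :=
  exteriorPower.pairingDual ℝ V 2 (wedge₂ α β) t

lemma wedge₂_add_left (a b c : V) : wedge₂ (a + b) c = wedge₂ a c + wedge₂ b c := by
  have h : ∀ x : V, Function.update ![a, c] 0 x = ![x, c] := by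
    intro x; funext i; fin_cases i <;> rfl
  have key := (exteriorPower.ιMulti ℝ 2 (M := V)).map_update_add ![a, c] 0 a b
  rwa [h, h, h] at key

lemma wedge₂_smul_left (r : ℝ) (a c : V) : wedge₂ (r • a) c = r • wedge₂ a c := by
  have h : ∀ x : V, Function.update ![a, c] 0 x = ![x, c] := by
    intro x; funext i; fin_cases i <;> rfl
  have key := (exteriorPower.ιMulti ℝ 2 (M := V)).map_update_smul ![a, c] 0 r a
  rwa [h, h] at key

lemma wedge₂_add_right (a b c : V) : wedge₂ c (a + b) = wedge₂ c a + wedge₂ c b := by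
  have h : ∀ x : V, Function.update ![c, a] 1 x = ![c, x] := by
    intro x; funext i; fin_cases i <;> rfl
  have key := (exteriorPower.ιMulti ℝ 2 (M := V)).map_update_add ![c, a] 1 a b
  rwa [h, h, h] at key

lemma wedge₂_smul_right (r : ℝ) (a c : V) : wedge₂ c (r • a) = r • wedge₂ c a := by
  have h : ∀ x : V, Function.update ![c, a] 1 x = ![c, x] := by
    intro x; funext i; fin_cases i <;> rfl
  have key := (exteriorPower.ιMulti ℝ 2 (M := V)).map_update_smul ![c, a] 1 r a
  rwa [h, h] at key

lemma bivectorEval_wedge₂ (v w : V) (α β : Module.Dual ℝ V) :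
    bivectorEval (wedge₂ v w) α β = α v * β w - α w * β v := by
  simp [bivectorEval, wedge₂, Matrix.det_fin_two]
  ring

/-- The bilinear form on `V*` given by a bivector `t ∈ Λ² V`. -/
def bivectorForm (t : ⋀[ℝ]^2 V) : LinearMap.BilinForm ℝ (Module.Dual ℝ V) :=
  LinearMap.mk₂ ℝ (bivectorEval t)
    (fun a b c => by simp [bivectorEval, wedge₂_add_left])
    (fun r a c => by simp [bivectorEval, wedge₂_smul_left])
    (fun c a b => by simp [bivectorEval, wedge₂_add_right])
    (fun r c a => by simp [bivectorEval, wedge₂_smul_right])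

lemma wedge₃_add₁ (a b c d : V) : wedge₃ (a + b) c d = wedge₃ a c d + wedge₃ b c d := by
  have h : ∀ x : V, Function.update ![a, c, d] 0 x = ![x, c, d] := by
    intro x; funext i; fin_cases i <;> rfl
  have key := (exteriorPower.ιMulti ℝ 3 (M := V)).map_update_add ![a, c, d] 0 a b
  rwa [h, h, h] at key

lemma wedge₃_smul₁ (r : ℝ) (a c d : V) : wedge₃ (r • a) c d = r • wedge₃ a c d := by
  have h : ∀ x : V, Function.update ![a, c, d] 0 x = ![x, c, d] := by
    intro x; funext i; fin_cases i <;> rfl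
  have key := (exteriorPower.ιMulti ℝ 3 (M := V)).map_update_smul ![a, c, d] 0 r a
  rwa [h, h] at key

lemma wedge₃_add₂ (a b c d : V) : wedge₃ c (a + b) d = wedge₃ c a d + wedge₃ c b d := by
  have h : ∀ x : V, Function.update ![c, a, d] 1 x = ![c, x, d] := by
    intro x; funext i; fin_cases i <;> rfl
  have key := (exteriorPower.ιMulti ℝ 3 (M := V)).map_update_add ![c, a, d] 1 a b
  rwa [h, h, h] at key

lemma wedge₃_smul₂ (r : ℝ) (a c d : V) : wedge₃ c (r • a) d = r • wedge₃ c a d := by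
  have h : ∀ x : V, Function.update ![c, a, d] 1 x = ![c, x, d] := by
    intro x; funext i; fin_cases i <;> rfl
  have key := (exteriorPower.ιMulti ℝ 3 (M := V)).map_update_smul ![c, a, d] 1 r a
  rwa [h, h] at key

lemma wedge₃_add₃ (a b c d : V) : wedge₃ c d (a + b) = wedge₃ c d a + wedge₃ c d b := by
  have h : ∀ x : V, Function.update ![c, d, a] 2 x = ![c, d, x] := by
    intro x; funext i; fin_cases i <;> rfl
  have key := (exteriorPower.ιMulti ℝ 3 (M := V)).map_update_add ![c, d, a] 2 a b
  rwa [h, h, h] at key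

lemma wedge₃_smul₃ (r : ℝ) (a c d : V) : wedge₃ c d (r • a) = r • wedge₃ c d a := by
  have h : ∀ x : V, Function.update ![c, d, a] 2 x = ![c, d, x] := by
    intro x; funext i; fin_cases i <;> rfl
  have key := (exteriorPower.ιMulti ℝ 3 (M := V)).map_update_smul ![c, d, a] 2 r a
  rwa [h, h] at key

lemma wedge₃_self₂₃ (a b : V) : wedge₃ a b b = 0 :=
  (exteriorPower.ιMulti ℝ 3 (M := V)).map_eq_zero_of_eq ![a, b, b]
    (i := 1) (j := 2) rfl (by decide)

/-- The linear map on `Λ² V` induced by an alternating bilinear map on `V`. -/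
def lift₂ {N : Type*} [AddCommGroup N] [Module ℝ N] (B : V →ₗ[ℝ] V →ₗ[ℝ] N)
    (hB : ∀ v, B v v = 0) : ⋀[ℝ]^2 V →ₗ[ℝ] N :=
  exteriorPower.alternatingMapLinearEquiv
    { toFun := fun x => B (x 0) (x 1)
      map_update_add' := by
        intro inst x i a b
        fin_cases i <;> simp [Function.update]
      map_update_smul' := by
        intro inst x i r a
        fin_cases i <;> simp [Function.update]
      map_eq_zero_of_eq' := by
        intro x i j hx hij
        have h : x 0 = x 1 := by
          fin_cases i <;> fin_cases j <;> simp_all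
        simp [h, hB] }

@[simp] lemma lift₂_wedge₂ {N : Type*} [AddCommGroup N] [Module ℝ N] (B : V →ₗ[ℝ] V →ₗ[ℝ] N)
    (hB : ∀ v, B v v = 0) (v w : V) : lift₂ B hB (wedge₂ v w) = B v w := by
  simp [lift₂, wedge₂]

end Algebra

section Schouten

variable {L : Type*} [LieRing L] [LieAlgebra ℝ L]

/-- `[a ∧ b, c ∧ d] = [a,c] ∧ b ∧ d - [a,d] ∧ b ∧ c - [b,c] ∧ a ∧ d + [b,d] ∧ a ∧ c`. -/
def schoutenAux (a b c d : L) : ⋀[ℝ]^3 L :=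
  wedge₃ ⁅a, c⁆ b d - wedge₃ ⁅a, d⁆ b c - wedge₃ ⁅b, c⁆ a d + wedge₃ ⁅b, d⁆ a c

/-- For fixed `a, b`, the map `[a ∧ b, ·] : Λ² L → Λ³ L`. -/
def schoutenAux₁ (a b : L) : ⋀[ℝ]^2 L →ₗ[ℝ] ⋀[ℝ]^3 L :=
  lift₂ (LinearMap.mk₂ ℝ (schoutenAux a b)
      (fun x y z => by
        simp only [schoutenAux, lie_add, wedge₃_add₁, wedge₃_add₃]; abel)
      (fun r x y => by
        simp only [schoutenAux, lie_smul, wedge₃_smul₁, wedge₃_smul₃,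
          smul_add, smul_sub])
      (fun x y z => by
        simp only [schoutenAux, lie_add, wedge₃_add₁, wedge₃_add₃]; abel)
      (fun r x y => by
        simp only [schoutenAux, lie_smul, wedge₃_smul₁, wedge₃_smul₃,
          smul_add, smul_sub]))
    (fun v => by simp [schoutenAux])

lemma lin_ext₂ {V N : Type*} [AddCommGroup V] [Module ℝ V] [AddCommGroup N] [Module ℝ N]
    {f g : ⋀[ℝ]^2 V →ₗ[ℝ] N} (h : ∀ v w, f (wedge₂ v w) = g (wedge₂ v w)) : f = g := by
  apply exteriorPower.linearMap_ext
  ext x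
  have hx : x = ![x 0, x 1] := by funext i; fin_cases i <;> rfl
  rw [hx]
  exact h _ _

/-- The (algebraic) Schouten bracket `Λ² L × Λ² L → Λ³ L`. -/
def schouten : ⋀[ℝ]^2 L →ₗ[ℝ] ⋀[ℝ]^2 L →ₗ[ℝ] ⋀[ℝ]^3 L :=
  lift₂ (LinearMap.mk₂ ℝ schoutenAux₁
      (fun x y z => lin_ext₂ fun v w => by
        simp only [schoutenAux₁, lift₂_wedge₂, LinearMap.add_apply, LinearMap.mk₂_apply,
          schoutenAux, add_lie, wedge₃_add₁, wedge₃_add₂]; abel)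
      (fun r x y => lin_ext₂ fun v w => by
        simp only [schoutenAux₁, lift₂_wedge₂, LinearMap.smul_apply, LinearMap.mk₂_apply,
          schoutenAux, smul_lie, wedge₃_smul₁, wedge₃_smul₂, smul_add, smul_sub])
      (fun x y z => lin_ext₂ fun v w => by
        simp only [schoutenAux₁, lift₂_wedge₂, LinearMap.add_apply, LinearMap.mk₂_apply,
          schoutenAux, add_lie, wedge₃_add₁, wedge₃_add₂]; abel)
      (fun r x y => lin_ext₂ fun v w => by
        simp only [schoutenAux₁, lift₂_wedge₂, LinearMap.smul_apply, LinearMap.mk₂_apply,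
          schoutenAux, smul_lie, wedge₃_smul₁, wedge₃_smul₂, smul_add, smul_sub]))
    (fun v => lin_ext₂ fun a b => by
      simp only [schoutenAux₁, lift₂_wedge₂, LinearMap.mk₂_apply, schoutenAux,
        LinearMap.zero_apply]; abel)

lemma schouten_wedge₂ (a b c d : L) :
    schouten (wedge₂ a b) (wedge₂ c d) = schoutenAux a b c d := by
  simp [schouten, schoutenAux₁]

/-- A Lie algebra is reductive if it is the direct sum of its centre and a semisimple ideal. -/
def IsReductive (L : Type*) [LieRing L] [LieAlgebra ℝ L] : Prop :=
  ∃ S : LieIdeal ℝ L, LieAlgebra.HasTrivialRadical ℝ S ∧ IsCompl S (LieAlgebra.center ℝ L)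

end Schouten

/-! ### Symplectic and Poisson structures on a smooth manifold -/

section Symplectic

variable (F : Type*) [NormedAddCommGroup F] [NormedSpace ℝ F] [FiniteDimensional ℝ F]
  (M : Type*) [TopologicalSpace M] [ChartedSpace F M]

instance (p : M) : FiniteDimensional ℝ (TangentSpace 𝓘(ℝ, F) p) :=
  inferInstanceAs (FiniteDimensional ℝ F)

variable {F M}

/-- A vector field on `M` is smooth. -/
def SmoothField (U : Π p : M, TangentSpace 𝓘(ℝ, F) p) [IsManifold 𝓘(ℝ, F) ∞ M] : Prop :=
  ContMDiff 𝓘(ℝ, F) 𝓘(ℝ, F).tangent ∞ (fun p => (⟨p, U p⟩ : TangentBundle 𝓘(ℝ, F) M))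

/-- The value at `p` of the exterior derivative of a 2-form on three vector fields:
`dΩ(U,V,W) = U Ω(V,W) - V Ω(U,W) + W Ω(U,V) - Ω([U,V],W) + Ω([U,W],V) - Ω([V,W],U)`. -/
def dTwoForm (Ω : Π p : M, TangentSpace 𝓘(ℝ, F) p →L[ℝ] TangentSpace 𝓘(ℝ, F) p →L[ℝ] ℝ)
    (U V W : Π p : M, TangentSpace 𝓘(ℝ, F) p) (p : M) : ℝ :=
  mvfderiv 𝓘(ℝ, F) (fun q => Ω q (V q) (W q)) p (U p)
    - mvfderiv 𝓘(ℝ, F) (fun q => Ω q (U q) (W q)) p (V p)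
    + mvfderiv 𝓘(ℝ, F) (fun q => Ω q (U q) (V q)) p (W p)
    - Ω p (VectorField.mlieBracket 𝓘(ℝ, F) U V p) (W p)
    + Ω p (VectorField.mlieBracket 𝓘(ℝ, F) U W p) (V p)
    - Ω p (VectorField.mlieBracket 𝓘(ℝ, F) V W p) (U p)

variable (F M) in
/-- A symplectic form on `M`: a smooth, closed, nondegenerate 2-form. -/
structure SymplecticForm [IsManifold 𝓘(ℝ, F) ∞ M] where
  form : Π p : M, TangentSpace 𝓘(ℝ, F) p →L[ℝ] TangentSpace 𝓘(ℝ, F) p →L[ℝ] ℝ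
  alt : ∀ p u, form p u u = 0
  smooth : ContMDiff 𝓘(ℝ, F) (𝓘(ℝ, F).prod 𝓘(ℝ, F →L[ℝ] F →L[ℝ] ℝ)) ∞
    (fun p => Bundle.TotalSpace.mk' (F →L[ℝ] F →L[ℝ] ℝ)
      (E := fun p : M => TangentSpace 𝓘(ℝ, F) p →L[ℝ] TangentSpace 𝓘(ℝ, F) p →L[ℝ] ℝ)
      p (form p))
  closed : ∀ U V W : Π p : M, TangentSpace 𝓘(ℝ, F) p,
    SmoothField U → SmoothField V → SmoothField W → ∀ p, dTwoForm form U V W p = 0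
  nondeg : ∀ p u, (∀ v, form p u v = 0) → u = 0

variable (F M) in
/-- Fields of bilinear forms on the cotangent spaces of `M`. A 2-vector field is such a field which
is alternating at every point. -/
abbrev BivectorField : Type _ :=
  Π p : M, LinearMap.BilinForm ℝ (Module.Dual ℝ (TangentSpace 𝓘(ℝ, F) p))

/-- The differential of a function at a point, as a covector. -/
def differential (f : M → ℝ) (p : M) : Module.Dual ℝ (TangentSpace 𝓘(ℝ, F) p) :=
  (mvfderiv 𝓘(ℝ, F) f p).toLinearMap

/-- The bracket `{f, g} = π(df, dg)`. -/
def bivectorBracket (π : BivectorField F M) (f g : M → ℝ) (p : M) : ℝ :=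
  π p (differential f p) (differential g p)

/-- `π` is a Poisson structure: a smooth 2-vector field whose bracket on smooth functions
satisfies the Jacobi identity, that is, whose Schouten square `[π, π]` vanishes. -/
structure IsPoisson (π : BivectorField F M) : Prop where
  alt : ∀ p α, π p α α = 0
  smooth : ∀ f g : M → ℝ, ContMDiff 𝓘(ℝ, F) 𝓘(ℝ, ℝ) ∞ f → ContMDiff 𝓘(ℝ, F) 𝓘(ℝ, ℝ) ∞ g →
    ContMDiff 𝓘(ℝ, F) 𝓘(ℝ, ℝ) ∞ (bivectorBracket π f g)
  jacobi : ∀ f g h : M → ℝ, ContMDiff 𝓘(ℝ, F) 𝓘(ℝ, ℝ) ∞ f →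
    ContMDiff 𝓘(ℝ, F) 𝓘(ℝ, ℝ) ∞ g → ContMDiff 𝓘(ℝ, F) 𝓘(ℝ, ℝ) ∞ h → ∀ p,
    bivectorBracket π f (bivectorBracket π g h) p
      + bivectorBracket π g (bivectorBracket π h f) p
      + bivectorBracket π h (bivectorBracket π f g) p = 0

namespace SymplecticForm

variable [IsManifold 𝓘(ℝ, F) ∞ M]

/-- The bilinear form on `T_p M` underlying a symplectic form. -/
def bilin (Ω : SymplecticForm F M) (p : M) : LinearMap.BilinForm ℝ (TangentSpace 𝓘(ℝ, F) p) :=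
  LinearMap.mk₂ ℝ (fun u v => Ω.form p u v) (by simp) (by simp) (by simp) (by simp)

lemma bilin_isAlt (Ω : SymplecticForm F M) (p : M) : (Ω.bilin p).IsAlt := fun u => Ω.alt p u

lemma bilin_nondegenerate (Ω : SymplecticForm F M) (p : M) : (Ω.bilin p).Nondegenerate :=
  (Ω.bilin_isAlt p).isRefl.nondegenerate_iff_separatingLeft.2 (Ω.nondeg p)

/-- The isomorphism `T_p M → T_p* M`, `v ↦ ι_v Ω`. -/
def flat (Ω : SymplecticForm F M) (p : M) :
    TangentSpace 𝓘(ℝ, F) p ≃ₗ[ℝ] Module.Dual ℝ (TangentSpace 𝓘(ℝ, F) p) :=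
  (Ω.bilin p).toDual (Ω.bilin_nondegenerate p)

lemma flat_apply (Ω : SymplecticForm F M) (p : M) (u v : TangentSpace 𝓘(ℝ, F) p) :
    Ω.flat p u v = Ω.form p u v := rfl

/-- The 2-vector field `π` induced by `Ω`: `π(α, β) = β(v)`, where `v` is the tangent vector with
`ι_v Ω = α`. -/
def poisson (Ω : SymplecticForm F M) : BivectorField F M := fun p =>
  LinearMap.mk₂ ℝ (fun α β => β ((Ω.flat p).symm α)) (by simp) (by simp) (by simp) (by simp)

end SymplecticForm

end Symplectic

/-! ### The Lie group `G`, the group `T*G = G ⋉ 𝔤*` and the dressing action -/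

section Group

variable (E : Type*) [NormedAddCommGroup E] [NormedSpace ℝ E]
  {G : Type*} [TopologicalSpace G] [ChartedSpace E G] [Group G]

instance [LieGroup 𝓘(ℝ, E) ∞ G] : LieGroup 𝓘(ℝ, E) (minSmoothness ℝ 3) G :=
  LieGroup.of_le (n := ∞) (by
    rw [minSmoothness_of_isRCLikeNormedField]
    exact ENat.LEInfty.out)

/-- The adjoint action of `G` on `𝔤 = T_1 G`. -/
def Ad (g : G) : GroupLieAlgebra 𝓘(ℝ, E) G →L[ℝ] GroupLieAlgebra 𝓘(ℝ, E) G :=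
  mfderiv 𝓘(ℝ, E) 𝓘(ℝ, E) (fun x : G => g * x * g⁻¹) 1

/-- The dual `𝔤*` of `𝔤 = T_1 G`; as a vector space `T_1 G` is the model space `E`. -/
abbrev CoLie : Type _ := StrongDual ℝ E

/-- The coadjoint action `Ad*_g ξ = ξ ∘ Ad_{g⁻¹}` of `G` on `𝔤*`. -/
def coAd (g : G) (ξ : CoLie E) : CoLie E := ξ.comp (Ad E g⁻¹)

lemma Ad_one : Ad E (1 : G) = ContinuousLinearMap.id ℝ _ := by
  have h : (fun x : G => 1 * x * 1⁻¹) = id := by funext x; simp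
  rw [Ad, h]
  exact mfderiv_id

lemma coAd_add (g : G) (ξ η : CoLie E) : coAd E g (ξ + η) = coAd E g ξ + coAd E g η := rfl

lemma coAd_neg (g : G) (ξ : CoLie E) : coAd E g (-ξ) = -coAd E g ξ := rfl

lemma coAd_zero (g : G) : coAd E g (0 : CoLie E) = 0 := rfl

section AdLemmas

variable [LieGroup 𝓘(ℝ, E) ∞ G]

lemma conj_smooth (g : G) :
    ContMDiff 𝓘(ℝ, E) 𝓘(ℝ, E) ∞ (fun x : G => g * x * g⁻¹) :=
  (contMDiff_const.mul contMDiff_id).mul contMDiff_const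

lemma Ad_mul (g h : G) : Ad E (g * h) = (Ad E g).comp (Ad E h) := by
  have e : (fun x : G => g * h * x * (g * h)⁻¹)
      = (fun x : G => g * x * g⁻¹) ∘ (fun x : G => h * x * h⁻¹) := by
    funext x; simp [mul_assoc]
  have d : ∀ (k y : G), MDifferentiableAt 𝓘(ℝ, E) 𝓘(ℝ, E) (fun x : G => k * x * k⁻¹) y :=
    fun k y => (conj_smooth E k).mdifferentiable (by simp) y
  have hy : h * 1 * h⁻¹ = (1 : G) := by simp
  have k : ∀ y : G, y = 1 → ∀ v : E,
      (mfderiv 𝓘(ℝ, E) 𝓘(ℝ, E) (fun x : G => g * x * g⁻¹) y : E →L[ℝ] E) v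
        = (Ad E g : E →L[ℝ] E) v := by
    rintro _ rfl v; rfl
  rw [Ad, e, mfderiv_comp (I' := 𝓘(ℝ, E)) (1 : G) (d g _) (d h 1)]
  exact ContinuousLinearMap.ext fun v => k _ hy _

lemma coAd_one (ξ : CoLie E) : coAd E (1 : G) ξ = ξ := by
  rw [coAd, inv_one, Ad_one]; rfl

lemma coAd_mul (g h : G) (ξ : CoLie E) : coAd E (g * h) ξ = coAd E g (coAd E h ξ) := by
  rw [coAd, mul_inv_rev, Ad_mul]; rfl

end AdLemmas

variable (G) in
/-- The manifold `T*G ≅ G × 𝔤*`, which carries the group structure of the semidirect product with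
respect to the coadjoint action. -/
def CotangentGroup : Type _ := G × CoLie E

namespace CotangentGroup

instance : TopologicalSpace (CotangentGroup E G) :=
  inferInstanceAs (TopologicalSpace (G × CoLie E))

instance : ChartedSpace (ModelProd E (CoLie E)) (CotangentGroup E G) :=
  inferInstanceAs (ChartedSpace (ModelProd E (CoLie E)) (G × CoLie E))

variable [LieGroup 𝓘(ℝ, E) ∞ G]

/-- The product is `(g, α) (h, β) = (g h, α + Ad*_g β)`. -/
instance : Group (CotangentGroup E G) where
  mul d d' := (d.1 * d'.1, d.2 + coAd E d.1 d'.2)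
  one := (1, 0)
  inv d := (d.1⁻¹, -coAd E d.1⁻¹ d.2)
  mul_assoc a b c := Prod.ext (mul_assoc a.1 b.1 c.1) (by
    change a.2 + coAd E a.1 b.2 + coAd E (a.1 * b.1) c.2
      = a.2 + coAd E a.1 (b.2 + coAd E b.1 c.2)
    rw [coAd_mul, coAd_add, add_assoc])
  one_mul a := Prod.ext (one_mul a.1) (by
    change 0 + coAd E (1 : G) a.2 = a.2
    rw [coAd_one, zero_add])
  mul_one a := Prod.ext (mul_one a.1) (by
    change a.2 + coAd E a.1 0 = a.2
    rw [coAd_zero, add_zero])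
  inv_mul_cancel a := Prod.ext (inv_mul_cancel a.1) (by
    change -coAd E a.1⁻¹ a.2 + coAd E a.1⁻¹ a.2 = 0
    rw [neg_add_cancel])

/-- `G` as a subgroup of `T*G`. -/
def base : Subgroup (CotangentGroup E G) where
  carrier := {d | d.2 = 0}
  mul_mem' {a b} ha hb := by
    change a.2 + coAd E a.1 b.2 = 0
    rw [show a.2 = 0 from ha, show b.2 = 0 from hb, coAd_zero, add_zero]
  one_mem' := rfl
  inv_mem' {a} ha := by
    change -coAd E a.1⁻¹ a.2 = 0
    rw [show a.2 = 0 from ha, coAd_zero, neg_zero]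

/-- The dressing action of `T*G` on `T*G / G`, where the latter is identified with `𝔤*` through
`(g, α) G ↦ α`, see `quotientEquiv` and `quotientEquiv_smul`. -/
instance : MulAction (CotangentGroup E G) (CoLie E) where
  smul d η := d.2 + coAd E d.1 η
  one_smul η := by
    change 0 + coAd E (1 : G) η = η
    rw [coAd_one, zero_add]
  mul_smul a b η := by
    change a.2 + coAd E a.1 b.2 + coAd E (a.1 * b.1) η = a.2 + coAd E a.1 (b.2 + coAd E b.1 η)
    rw [coAd_mul, coAd_add, add_assoc]

/-- The identification `T*G / G ≅ 𝔤*`. -/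
def quotientEquiv : CotangentGroup E G ⧸ base E (G := G) ≃ CoLie E where
  toFun := Quotient.lift (fun d => d.2) (by
    intro a b hab
    have h : -coAd E a.1⁻¹ a.2 + coAd E a.1⁻¹ b.2 = 0 := QuotientGroup.leftRel_apply.1 hab
    have h' := congrArg (coAd E a.1) (neg_add_eq_zero.1 h)
    rwa [← coAd_mul, ← coAd_mul, mul_inv_cancel, coAd_one, coAd_one] at h')
  invFun η := QuotientGroup.mk ((1, η) : G × CoLie E)
  left_inv := by
    rintro ⟨d⟩
    refine QuotientGroup.eq.2 ?_
    change -coAd E (1 : G)⁻¹ d.2 + coAd E (1 : G)⁻¹ d.2 = 0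
    rw [neg_add_cancel]
  right_inv _ := rfl

lemma quotientEquiv_smul (d : CotangentGroup E G) (s : CotangentGroup E G ⧸ base E (G := G)) :
    quotientEquiv E (d • s) = d • quotientEquiv E s := by
  obtain ⟨d'⟩ := s
  rfl

end CotangentGroup

variable (G) in
/-- The vector space `𝔡 = 𝔤 ⊕ 𝔤*`, the tangent space of `T*G` at the identity. -/
abbrev Double : Type _ := GroupLieAlgebra 𝓘(ℝ, E) G × CoLie E

/-- The invariant scalar product `(X + ξ | Y + η) = ξ(Y) + η(X)` on `𝔡`. -/
def doublePairing (x y : Double E G) : ℝ := x.2 y.1 + y.2 x.1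

/-- `𝔤` as a subspace of `𝔡`. -/
def lieSubspace : Submodule ℝ (Double E G) := Submodule.prod ⊤ ⊥

/-- `𝔥` is an isotropic complement of `𝔤` in `𝔡`. -/
def IsIsotropicComplement (𝔥 : Submodule ℝ (Double E G)) : Prop :=
  (∀ x ∈ 𝔥, ∀ y ∈ 𝔥, doublePairing E x y = 0) ∧ IsCompl (lieSubspace E) 𝔥

/-- The infinitesimal dressing action: the value at `η ∈ 𝔤*` of the vector field on `𝔤* ≅ T*G / G`
generated by `x ∈ 𝔡`, i.e. the derivative at the identity of `d ↦ d • η` in the direction `x`. -/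
def infDressing [LieGroup 𝓘(ℝ, E) ∞ G] (η : CoLie E) (x : Double E G) : CoLie E :=
  mfderiv (𝓘(ℝ, E).prod 𝓘(ℝ, CoLie E)) 𝓘(ℝ, CoLie E)
    (fun d : CotangentGroup E G => d • η) 1 x

/-- `𝔥` is admissible at `η`: the infinitesimal dressing action maps `𝔥` isomorphically onto
`T_η 𝔤* = 𝔤*`. -/
def IsAdmissibleAt [LieGroup 𝓘(ℝ, E) ∞ G] (𝔥 : Submodule ℝ (Double E G)) (η : CoLie E) : Prop :=
  Function.Bijective (fun x : 𝔥 => infDressing E η (x : Double E G))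

/-- The quasi-triple `(T*G, G, 𝔥)` is complete: `𝔥` is an isotropic complement of `𝔤` which is
admissible at every point of `𝔤*`. -/
def IsCompleteTriple [LieGroup 𝓘(ℝ, E) ∞ G] (𝔥 : Submodule ℝ (Double E G)) : Prop :=
  IsIsotropicComplement E 𝔥 ∧ ∀ η : CoLie E, IsAdmissibleAt E 𝔥 η

variable (G) in
/-- An element of `𝔤*` as a linear form on `𝔤 = T_1 G`. -/
def toForm : CoLie E →ₗ[ℝ] Module.Dual ℝ (GroupLieAlgebra 𝓘(ℝ, E) G) :=
  (ContinuousLinearMap.coeLM ℝ : (E →L[ℝ] ℝ) →ₗ[ℝ] (E →ₗ[ℝ] ℝ))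

/-- The subspace `𝔤*_t = {ξ + t♯ξ | ξ ∈ 𝔤*}` of `𝔡`, where `t♯ξ ∈ 𝔤` is the vector with
`η(t♯ξ) = t(ξ, η)` for all `η ∈ 𝔤*`. -/
def twistedComplement (t : ⋀[ℝ]^2 (GroupLieAlgebra 𝓘(ℝ, E) G)) :
    Submodule ℝ (Double E G) where
  carrier := {x | ∀ η : Module.Dual ℝ (GroupLieAlgebra 𝓘(ℝ, E) G),
    η x.1 = bivectorForm t (toForm E G x.2) η}
  add_mem' {a b} ha hb := by
    intro η
    rw [Prod.snd_add, map_add, map_add, LinearMap.add_apply, Prod.fst_add, map_add, ha η, hb η]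
  zero_mem' := by
    intro η
    rw [Prod.snd_zero, map_zero, map_zero, LinearMap.zero_apply, Prod.fst_zero, map_zero]
  smul_mem' r a ha := by
    intro η
    rw [Prod.smul_snd, map_smul, map_smul, LinearMap.smul_apply, Prod.smul_fst, map_smul, ha η]

end Group

/-! ### Hamiltonian actions and twisted bivector fields -/

section Action

variable {E : Type*} [NormedAddCommGroup E] [NormedSpace ℝ E]
  {G : Type*} [TopologicalSpace G] [ChartedSpace E G] [Group G]
  {F : Type*} [NormedAddCommGroup F] [NormedSpace ℝ F] [FiniteDimensional ℝ F]
  {M : Type*} [TopologicalSpace M] [ChartedSpace F M] [MulAction G M]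

variable (E G F) in
/-- The linear map `𝔤 → T_p M`, `X ↦ X_M(p)`, where `X_M` is the fundamental vector field
`X_M(p) = d/ds exp(s X) p` at `s = 0`, i.e. the derivative of `g ↦ g p` at `1` in the
direction `X`. -/
def fundamental (p : M) : GroupLieAlgebra 𝓘(ℝ, E) G →L[ℝ] TangentSpace 𝓘(ℝ, F) p :=
  (mfderiv 𝓘(ℝ, E) 𝓘(ℝ, F) (fun g : G => g • p) 1 : E →L[ℝ] F)

/-- The fundamental 2-vector field `t_M` of `t ∈ Λ² 𝔤`: its value at `p` is the image of `t`
under the map `Λ² 𝔤 → Λ² T_p M` induced by `X ↦ X_M(p)`. -/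
def fundamentalBivector (t : ⋀[ℝ]^2 (GroupLieAlgebra 𝓘(ℝ, E) G)) : BivectorField F M := fun p =>
  bivectorForm (exteriorPower.map 2 (fundamental E G F p).toLinearMap t)

/-- The action of `G` on `(M, Ω)` is smooth and symplectic, and `μ : M → 𝔤*` is a moment map:
`d⟨μ, X⟩ = ι_{X_M} Ω` for all `X ∈ 𝔤`, and `μ` is equivariant for the coadjoint action. -/
structure IsHamiltonianAction [IsManifold 𝓘(ℝ, F) ∞ M] (Ω : SymplecticForm F M)
    (μ : M → CoLie E) : Prop where
  smooth_action : ContMDiff (𝓘(ℝ, E).prod 𝓘(ℝ, F)) 𝓘(ℝ, F) ∞ (fun q : G × M => q.1 • q.2)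
  symplectic : ∀ (g : G) (p : M) (u v : TangentSpace 𝓘(ℝ, F) p),
    Ω.form (g • p) (mfderiv 𝓘(ℝ, F) 𝓘(ℝ, F) (fun q : M => g • q) p u)
      (mfderiv 𝓘(ℝ, F) 𝓘(ℝ, F) (fun q : M => g • q) p v) = Ω.form p u v
  smooth_moment : ContMDiff 𝓘(ℝ, F) 𝓘(ℝ, CoLie E) ∞ μ
  moment : ∀ (X : GroupLieAlgebra 𝓘(ℝ, E) G) (p : M) (v : TangentSpace 𝓘(ℝ, F) p),
    mvfderiv 𝓘(ℝ, F) (fun q => μ q X) p v = Ω.form p (fundamental E G F p X) v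
  equivariant : ∀ (g : G) (p : M), μ (g • p) = coAd E g (μ p)

/-- The 2-vector field `π_t = π - t_M`, where `π` is induced by the symplectic form `Ω`. -/
def twistedPoisson [IsManifold 𝓘(ℝ, F) ∞ M] (Ω : SymplecticForm F M)
    (t : ⋀[ℝ]^2 (GroupLieAlgebra 𝓘(ℝ, E) G)) : BivectorField F M := fun p =>
  Ω.poisson p - fundamentalBivector t p

/-- The twist `t` deforms `Ω` to a symplectic form: the 2-vector field `π - t_M` is a nondegenerate
Poisson structure, and it is induced by a (unique) symplectic form `Ω_t`. -/
def DeformsSymplectic [IsManifold 𝓘(ℝ, F) ∞ M] (Ω : SymplecticForm F M)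
    (t : ⋀[ℝ]^2 (GroupLieAlgebra 𝓘(ℝ, E) G)) : Prop :=
  IsPoisson (twistedPoisson Ω t) ∧
  (∀ p, (twistedPoisson Ω t p).Nondegenerate) ∧
  ∃! Ωt : SymplecticForm F M, Ωt.poisson = twistedPoisson Ω t

end Action

end SympTwist

/-!
Both cases of the theorem concern a bivector `t ∈ Λ² A` with `A ⊆ 𝔤` an abelian subalgebra: the span
of `X` and `Y`, or the Cartan subalgebra `𝔥`. A Cartan subalgebra of a reductive Lie algebra
contains the centre, and its trace on the semisimple ideal is a Cartan subalgebra there, hence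
abelian (`IsReductive.isLieAbelian_of_isCartanSubalgebra`).

Let `A` be abelian and `t ∈ Λ² A`. The Schouten square `[t, t]` is a sum of terms each containing
a bracket of elements of `A`, so it vanishes (`schouten_self_eq_zero`). Two properties of
`t♯ : 𝔤* → 𝔤` give the rest: its image lies in `A` (`sharp_mem`), and it kills the covectors which
vanish on `A` (`sharp_eq_zero`).

*Completeness.* The derivative at `1` of `g ↦ Ad_{g⁻¹}` is `X ↦ -ad X`
(`exists_hasMFDerivAt_Ad_inv`), so the infinitesimal dressing action at `η` maps `ξ + t♯ξ` to
`ξ - η ∘ ad (t♯ξ)`. If this is zero, then `ξ` vanishes on `A`, so `t♯ξ = 0`, and then `ξ = 0`; by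
equality of dimensions the dressing action is bijective on `𝔤*_t`
(`isAdmissibleAt_twistedComplement`).

*Deformation.* The symplectic form is `ω_t = ω - t(dμ, dμ)`, where the second term is the pullback
by `μ` of the bivector `t`, regarded as a constant 2-form on the vector space `𝔤*`. It is closed
because constant forms are closed. For a tangent vector `v` put `C v = v + (t♯ dμ(v))_M`. As `μ` is
a moment map, `ω(C v, u) = ω(v, u) + t(dμ(v), dμ(u))`, and `dμ(C v) - dμ(v)` evaluated on `X ∈ A` is
`ω(X_M, Y_M)` with `Y = t♯ dμ(v) ∈ A`, which vanishes since by equivariance it is `-μ([Y, X])`.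
So `t♯` takes the same value on `dμ(C v)` and `dμ(v)`, and therefore
`ω_t(C v, u) = ω(v, u)` (`IsHamiltonianAction.form_sub_pullbackForm_twist`). This shows that
`ω_t` is nondegenerate, and that the vector dual to `ι_v ω` with respect to `ω_t` is `C v`, that is,
`π_t = π - t_M` (`IsHamiltonianAction.poisson_twistedForm`). That the 2-vector field of a symplectic
form is a nondegenerate Poisson structure and determines the form is proved for every symplectic
form (`SymplecticForm.isPoisson_poisson`, `SymplecticForm.poisson_injective`).
-/

namespace SympTwist

/-! ### Bivectors and abelian subalgebras -/

section BivectorAlgebra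

variable {V W : Type*} [AddCommGroup V] [Module ℝ V] [AddCommGroup W] [Module ℝ W]

lemma map_wedge₂ (f : V →ₗ[ℝ] W) (v w : V) :
    exteriorPower.map 2 f (wedge₂ v w) = wedge₂ (f v) (f w) := by
  rw [wedge₂, exteriorPower.map_apply_ιMulti, wedge₂]
  congr 1
  funext i
  fin_cases i <;> rfl

/-- The linear map `t♯ : V* → V` of a bivector `t`, characterised by `β (t♯ α) = t(α, β)`;
on a decomposable bivector it is `(v ∧ w)♯ α = α v • w - α w • v`. -/
def sharp : ⋀[ℝ]^2 V →ₗ[ℝ] Module.Dual ℝ V →ₗ[ℝ] V :=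
  lift₂ (LinearMap.mk₂ ℝ
      (fun v w => (Module.Dual.eval ℝ V v).smulRight w - (Module.Dual.eval ℝ V w).smulRight v)
      (fun a b c => by ext α; simp [add_smul]; abel)
      (fun r a c => by ext α; simp [mul_smul, smul_sub, smul_comm r])
      (fun c a b => by ext α; simp [add_smul]; abel)
      (fun r c a => by ext α; simp [mul_smul, smul_sub, smul_comm r]))
    (fun v => by simp)

lemma sharp_wedge₂ (v w : V) (α : Module.Dual ℝ V) :
    sharp (wedge₂ v w) α = α v • w - α w • v := by
  simp [sharp]

lemma bivectorForm_wedge₂ (v w : V) (α β : Module.Dual ℝ V) :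
    bivectorForm (wedge₂ v w) α β = α v * β w - α w * β v :=
  bivectorEval_wedge₂ v w α β

lemma apply_sharp (t : ⋀[ℝ]^2 V) (α β : Module.Dual ℝ V) :
    β (sharp t α) = bivectorForm t α β := by
  have h : β ∘ₗ (LinearMap.applyₗ α) ∘ₗ sharp
      = exteriorPower.pairingDual ℝ V 2 (wedge₂ α β) :=
    lin_ext₂ fun v w => by
      change β (sharp (wedge₂ v w) α) = bivectorForm (wedge₂ v w) α β
      simp [sharp_wedge₂, bivectorForm_wedge₂]
  exact LinearMap.congr_fun h t

lemma bivectorForm_self (t : ⋀[ℝ]^2 V) (α : Module.Dual ℝ V) : bivectorForm t α α = 0 := by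
  have h : exteriorPower.pairingDual ℝ V 2 (wedge₂ α α) = 0 :=
    lin_ext₂ fun v w => by
      change bivectorForm (wedge₂ v w) α α = 0
      rw [bivectorForm_wedge₂]; ring
  exact LinearMap.congr_fun h t

lemma bivectorForm_swap (t : ⋀[ℝ]^2 V) (α β : Module.Dual ℝ V) :
    bivectorForm t α β = -bivectorForm t β α :=
  (LinearMap.IsAlt.neg (B := bivectorForm t) (bivectorForm_self t) β α).symm

lemma sharp_map (f : V →ₗ[ℝ] W) (t : ⋀[ℝ]^2 V) (α : Module.Dual ℝ W) :
    sharp (exteriorPower.map 2 f t) α = f (sharp t (α ∘ₗ f)) := by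
  have h : (LinearMap.applyₗ α) ∘ₗ sharp ∘ₗ exteriorPower.map 2 f
      = f ∘ₗ (LinearMap.applyₗ (α ∘ₗ f)) ∘ₗ sharp :=
    lin_ext₂ fun v w => by
      change sharp (exteriorPower.map 2 f (wedge₂ v w)) α = f (sharp (wedge₂ v w) (α ∘ₗ f))
      simp [map_wedge₂, sharp_wedge₂]
  exact LinearMap.congr_fun h t

lemma bivectorForm_map (f : V →ₗ[ℝ] W) (t : ⋀[ℝ]^2 V) (α β : Module.Dual ℝ W) :
    bivectorForm (exteriorPower.map 2 f t) α β = bivectorForm t (α ∘ₗ f) (β ∘ₗ f) := by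
  rw [← apply_sharp, sharp_map, ← apply_sharp]; rfl

end BivectorAlgebra

section LieAlgebra

variable {L : Type*} [LieRing L] [LieAlgebra ℝ L]

/-- A bivector supported on a commuting subspace has vanishing Schouten square, since every term of
the Schouten bracket of two decomposable bivectors contains a bracket of their factors. -/
lemma schouten_self_eq_zero {A : Submodule ℝ L} (hA : ∀ x ∈ A, ∀ y ∈ A, ⁅x, y⁆ = 0)
    {t : ⋀[ℝ]^2 L} (ht : t ∈ LinearMap.range (exteriorPower.map 2 A.subtype)) :
    schouten t t = 0 := by
  obtain ⟨s, rfl⟩ := ht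
  have h : (schouten (L := L)).compl₁₂ (exteriorPower.map 2 A.subtype)
      (exteriorPower.map 2 A.subtype) = 0 :=
    lin_ext₂ fun a b => lin_ext₂ fun c d => by
      have hz : ∀ u v : L, wedge₃ 0 u v = 0 := fun u v => by
        simpa using wedge₃_smul₁ (0 : ℝ) 0 u v
      simp [map_wedge₂, schouten_wedge₂, schoutenAux, hz, hA _ a.2 _ c.2, hA _ a.2 _ d.2,
        hA _ b.2 _ c.2, hA _ b.2 _ d.2]
  exact LinearMap.congr_fun₂ h s s

lemma sharp_mem {A : Submodule ℝ L} {t : ⋀[ℝ]^2 L}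
    (ht : t ∈ LinearMap.range (exteriorPower.map 2 A.subtype)) (α : Module.Dual ℝ L) :
    sharp t α ∈ A := by
  obtain ⟨s, rfl⟩ := ht
  rw [sharp_map]
  exact Subtype.property _

lemma sharp_eq_zero {A : Submodule ℝ L} {t : ⋀[ℝ]^2 L}
    (ht : t ∈ LinearMap.range (exteriorPower.map 2 A.subtype)) {α : Module.Dual ℝ L}
    (hα : ∀ x ∈ A, α x = 0) : sharp t α = 0 := by
  have h : α ∘ₗ A.subtype = 0 := LinearMap.ext fun x => hα x x.2
  obtain ⟨s, rfl⟩ := ht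
  rw [sharp_map, h, map_zero, map_zero]

/-- A Cartan subalgebra of a reductive Lie algebra contains the centre, and its trace on the
semisimple ideal is a Cartan subalgebra of that ideal, which is abelian because the Killing form
of the ideal is nondegenerate. -/
lemma IsReductive.isLieAbelian_of_isCartanSubalgebra [FiniteDimensional ℝ L]
    (hL : IsReductive L) (H : LieSubalgebra ℝ L) (hH : H.IsCartanSubalgebra) :
    IsLieAbelian H := by
  obtain ⟨S, hS, hc⟩ := hL
  have hcen : ∀ z ∈ LieAlgebra.center ℝ L, ∀ x : L, ⁅z, x⁆ = 0 := fun z hz x => by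
    rw [← lie_skew, (LieModule.mem_maxTrivSubmodule ℝ L L z).1 hz x, neg_zero]
  have hcen' : ∀ z ∈ LieAlgebra.center ℝ L, ∀ x : L, ⁅x, z⁆ = 0 := fun z hz x =>
    (LieModule.mem_maxTrivSubmodule ℝ L L z).1 hz x
  have hsn : ∀ x : L, (∀ y ∈ H, ⁅x, y⁆ ∈ H) → x ∈ H := fun x hx => by
    rw [← hH.self_normalizing]
    exact (H.mem_normalizer_iff x).2 hx
  have hZ : ∀ z ∈ LieAlgebra.center ℝ L, z ∈ H := fun z hz =>
    hsn z fun y _ => by rw [hcen z hz]; exact H.zero_mem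
  have hdec : ∀ x ∈ H, ∃ s : S, ∃ z ∈ LieAlgebra.center ℝ L, (s : L) ∈ H ∧ (s : L) + z = x := by
    intro x hx
    have hx' : x ∈ S ⊔ LieAlgebra.center ℝ L := by rw [hc.sup_eq_top]; trivial
    obtain ⟨s, hs, z, hz, rfl⟩ := (LieSubmodule.mem_sup _ _ _).1 hx'
    refine ⟨⟨s, hs⟩, z, hz, ?_, rfl⟩
    simpa using H.sub_mem hx (hZ z hz)
  let K : LieSubalgebra ℝ S := H.comap S.incl
  have hmem : ∀ s : S, s ∈ K ↔ (s : L) ∈ H := fun s => Iff.rfl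
  have hK : K.IsCartanSubalgebra :=
    { nilpotent := by
        have := hH.nilpotent
        let f : K →ₗ⁅ℝ⁆ H :=
          { toFun := fun s => ⟨((s : S) : L), s.2⟩
            map_add' := fun _ _ => rfl
            map_smul' := fun _ _ => rfl
            map_lie' := rfl }
        exact Function.Injective.lieAlgebra_isNilpotent (f := f) fun a b hab =>
          Subtype.ext (Subtype.ext (congrArg (fun k : H => (k : L)) hab))
      self_normalizing := by
        refine le_antisymm (fun s hs => ?_) K.le_normalizer
        rw [LieSubalgebra.mem_normalizer_iff] at hs
        refine hsn s fun y hy => ?_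
        obtain ⟨s', z, hz, hs', rfl⟩ := hdec y hy
        rw [lie_add, hcen' z hz, add_zero]
        exact hs s' hs' }
  have hab : IsLieAbelian K := inferInstance
  refine ⟨fun x y => Subtype.ext ?_⟩
  obtain ⟨s, z, hz, hs, hx⟩ := hdec x x.2
  obtain ⟨s', z', hz', hs', hy⟩ := hdec y y.2
  have h := hab.trivial ⟨s, hs⟩ ⟨s', hs'⟩
  have h' : ⁅(s : L), (s' : L)⁆ = 0 := congrArg (fun k : K => ((k : S) : L)) h
  change ⁅(x : L), (y : L)⁆ = 0
  rw [← hx, ← hy, add_lie, lie_add, lie_add, h', hcen' z' hz', hcen z hz, hcen z hz]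
  simp

end LieAlgebra

/-! ### Vector fields in coordinates -/

section Coordinates

open VectorField Filter Topology

variable {F : Type*} [NormedAddCommGroup F] [NormedSpace ℝ F]
  {M : Type*} [TopologicalSpace M] [ChartedSpace F M]
  {N : Type*} [NormedAddCommGroup N] [NormedSpace ℝ N]

/-- The coordinate representation of a vector field `V` in the chart at `p`, as a map between
open subsets of the model space. -/
def coordField (p : M) (V : Π q : M, TangentSpace 𝓘(ℝ, F) q) : F → F :=
  mpullbackWithin 𝓘(ℝ, F) 𝓘(ℝ, F) (extChartAt 𝓘(ℝ, F) p).symm V (Set.range 𝓘(ℝ, F))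

lemma mvfderiv_eq_fderiv_self {p : M} {f : M → N}
    (hf : MDifferentiableAt 𝓘(ℝ, F) 𝓘(ℝ, N) f p) (v : TangentSpace 𝓘(ℝ, F) p) :
    mvfderiv 𝓘(ℝ, F) f p v
      = fderiv ℝ (f ∘ (extChartAt 𝓘(ℝ, F) p).symm) (extChartAt 𝓘(ℝ, F) p p) v := by
  rw [hf.mvfderiv, modelWithCornersSelf_coe, Set.range_id, fderivWithin_univ]
  rfl

variable [IsManifold 𝓘(ℝ, F) ∞ M]

lemma coordField_eq_mfderiv {p : M} {y : F} (hy : y ∈ (extChartAt 𝓘(ℝ, F) p).target)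
    (V : Π q : M, TangentSpace 𝓘(ℝ, F) q) :
    coordField p V y = mfderiv 𝓘(ℝ, F) 𝓘(ℝ, F) (extChartAt 𝓘(ℝ, F) p)
      ((extChartAt 𝓘(ℝ, F) p).symm y) (V ((extChartAt 𝓘(ℝ, F) p).symm y)) := by
  have hI : IsManifold 𝓘(ℝ, F) 1 M := IsManifold.of_le (n := ∞) (by simp)
  rw [coordField, mpullbackWithin_apply, ContinuousLinearMap.inverse_eq
    (mfderivWithin_extChartAt_symm_comp_mfderiv_extChartAt hy)
    (mfderiv_extChartAt_comp_mfderivWithin_extChartAt_symm hy)]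
  rfl

lemma coordField_self (p : M) (V : Π q : M, TangentSpace 𝓘(ℝ, F) q) :
    coordField p V (extChartAt 𝓘(ℝ, F) p p) = V p := by
  have hI : IsManifold 𝓘(ℝ, F) 1 M := IsManifold.of_le (n := ∞) (by simp)
  have h : ∀ q, q = p → (mfderiv 𝓘(ℝ, F) 𝓘(ℝ, F) (extChartAt 𝓘(ℝ, F) p) q (V q) : F)
      = V p := by
    rintro _ rfl
    rw [mfderiv_extChartAt_self]; rfl
  rw [coordField_eq_mfderiv (mem_extChartAt_target p)]
  exact h _ (extChartAt_to_inv p)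

lemma comp_extChartAt_symm_differentiableAt {p : M} {y : F}
    (hy : y ∈ (extChartAt 𝓘(ℝ, F) p).target) {f : M → N}
    (hf : MDifferentiableAt 𝓘(ℝ, F) 𝓘(ℝ, N) f ((extChartAt 𝓘(ℝ, F) p).symm y)) :
    DifferentiableAt ℝ (f ∘ (extChartAt 𝓘(ℝ, F) p).symm) y := by
  have hI : IsManifold 𝓘(ℝ, F) 1 M := IsManifold.of_le (n := ∞) (by simp)
  have h := mdifferentiableWithinAt_extChartAt_symm hy
  rw [modelWithCornersSelf_coe, Set.range_id, mdifferentiableWithinAt_univ] at h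
  exact (hf.comp y h).differentiableAt

lemma mvfderiv_extChartAt_symm {p : M} {y : F} (hy : y ∈ (extChartAt 𝓘(ℝ, F) p).target)
    {f : M → N} (hf : MDifferentiableAt 𝓘(ℝ, F) 𝓘(ℝ, N) f ((extChartAt 𝓘(ℝ, F) p).symm y))
    (v : TangentSpace 𝓘(ℝ, F) ((extChartAt 𝓘(ℝ, F) p).symm y)) :
    mvfderiv 𝓘(ℝ, F) f _ v = fderiv ℝ (f ∘ (extChartAt 𝓘(ℝ, F) p).symm) y
      (mfderiv 𝓘(ℝ, F) 𝓘(ℝ, F) (extChartAt 𝓘(ℝ, F) p) ((extChartAt 𝓘(ℝ, F) p).symm y) v) := by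
  have hI : IsManifold 𝓘(ℝ, F) 1 M := IsManifold.of_le (n := ∞) (by simp)
  have hs := (extChartAt 𝓘(ℝ, F) p).map_target hy
  have he : f =ᶠ[𝓝 ((extChartAt 𝓘(ℝ, F) p).symm y)]
      (f ∘ (extChartAt 𝓘(ℝ, F) p).symm) ∘ extChartAt 𝓘(ℝ, F) p := by
    filter_upwards [extChartAt_source_mem_nhds' hs] with q hq
    exact (congrArg f ((extChartAt 𝓘(ℝ, F) p).left_inv hq)).symm
  have hd : MDifferentiableAt 𝓘(ℝ, F) 𝓘(ℝ, F) (extChartAt 𝓘(ℝ, F) p)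
      ((extChartAt 𝓘(ℝ, F) p).symm y) :=
    mdifferentiableAt_extChartAt (by rwa [extChartAt_source] at hs)
  have h1 := (comp_extChartAt_symm_differentiableAt hy hf).mdifferentiableAt
  have h2 : mfderiv 𝓘(ℝ, F) 𝓘(ℝ, N) f ((extChartAt 𝓘(ℝ, F) p).symm y) v
      = mfderiv 𝓘(ℝ, F) 𝓘(ℝ, N) (f ∘ (extChartAt 𝓘(ℝ, F) p).symm) y
        (mfderiv 𝓘(ℝ, F) 𝓘(ℝ, F) (extChartAt 𝓘(ℝ, F) p) ((extChartAt 𝓘(ℝ, F) p).symm y) v) := by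
    rw [he.mfderiv_eq]
    exact mfderiv_comp_apply_of_eq _ h1 hd ((extChartAt 𝓘(ℝ, F) p).right_inv hy) v
  rw [mfderiv_eq_fderiv] at h2
  exact h2

lemma mvfderiv_apply_extChartAt_symm {p : M} {y : F} (hy : y ∈ (extChartAt 𝓘(ℝ, F) p).target)
    {f : M → N} (hf : MDifferentiableAt 𝓘(ℝ, F) 𝓘(ℝ, N) f ((extChartAt 𝓘(ℝ, F) p).symm y))
    (V : Π q : M, TangentSpace 𝓘(ℝ, F) q) :
    mvfderiv 𝓘(ℝ, F) f _ (V ((extChartAt 𝓘(ℝ, F) p).symm y))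
      = fderiv ℝ (f ∘ (extChartAt 𝓘(ℝ, F) p).symm) y (coordField p V y) := by
  rw [coordField_eq_mfderiv hy, mvfderiv_extChartAt_symm hy hf]

/-- At the base point of a chart, the bracket of two vector fields is the bracket of their
coordinate representations. -/
lemma mlieBracket_eq_lieBracket (p : M) (U V : Π q : M, TangentSpace 𝓘(ℝ, F) q) :
    mlieBracket 𝓘(ℝ, F) U V p
      = lieBracket ℝ (coordField p U) (coordField p V) (extChartAt 𝓘(ℝ, F) p p) := by
  have hI : IsManifold 𝓘(ℝ, F) 1 M := IsManifold.of_le (n := ∞) (by simp)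
  rw [← mlieBracketWithin_univ, mlieBracketWithin_apply, mfderiv_extChartAt_self]
  erw [ContinuousLinearMap.inverse_id]
  simp only [Set.preimage_univ, modelWithCornersSelf_coe, Set.range_id, Set.inter_univ]
  simp only [coordField, modelWithCornersSelf_coe, Set.range_id]
  exact congrFun (lieBracketWithin_univ (𝕜 := ℝ) (E := F)) _

lemma SmoothField.mdifferentiableAt {V : Π q : M, TangentSpace 𝓘(ℝ, F) q} (hV : SmoothField V)
    (p : M) : MDifferentiableAt 𝓘(ℝ, F) 𝓘(ℝ, F).tangent
      (fun q => (⟨q, V q⟩ : TangentBundle 𝓘(ℝ, F) M)) p :=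
  ContMDiff.mdifferentiable hV (by simp) p

lemma differentiableAt_coordField [CompleteSpace F] {p : M} {V : Π q : M, TangentSpace 𝓘(ℝ, F) q}
    (hV : MDifferentiableAt 𝓘(ℝ, F) 𝓘(ℝ, F).tangent
      (fun q => (⟨q, V q⟩ : TangentBundle 𝓘(ℝ, F) M)) p) :
    DifferentiableAt ℝ (coordField p V) (extChartAt 𝓘(ℝ, F) p p) := by
  have hI : IsManifold 𝓘(ℝ, F) 2 M := IsManifold.of_le (n := ∞) ENat.LEInfty.out
  have h := (mdifferentiableWithinAt_univ.2 hV
    ).differentiableWithinAt_mpullbackWithin_vectorField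
  simp only [Set.preimage_univ, modelWithCornersSelf_coe, Set.range_id, Set.inter_univ] at h
  simp only [coordField, modelWithCornersSelf_coe, Set.range_id]
  exact differentiableWithinAt_univ.1 h

/-- The bracket of vector fields is the commutator of the directional derivatives,
`[U, V] f = U (V f) - V (U f)`. -/
lemma mvfderiv_mlieBracket [CompleteSpace F] {f : M → N} (hf : ContMDiff 𝓘(ℝ, F) 𝓘(ℝ, N) ∞ f)
    {U V : Π q : M, TangentSpace 𝓘(ℝ, F) q} {p : M}
    (hU : MDifferentiableAt 𝓘(ℝ, F) 𝓘(ℝ, F).tangent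
      (fun q => (⟨q, U q⟩ : TangentBundle 𝓘(ℝ, F) M)) p)
    (hV : MDifferentiableAt 𝓘(ℝ, F) 𝓘(ℝ, F).tangent
      (fun q => (⟨q, V q⟩ : TangentBundle 𝓘(ℝ, F) M)) p)
    (hUf : MDifferentiableAt 𝓘(ℝ, F) 𝓘(ℝ, N) (fun q => mvfderiv 𝓘(ℝ, F) f q (U q)) p)
    (hVf : MDifferentiableAt 𝓘(ℝ, F) 𝓘(ℝ, N) (fun q => mvfderiv 𝓘(ℝ, F) f q (V q)) p) :
    mvfderiv 𝓘(ℝ, F) f p (mlieBracket 𝓘(ℝ, F) U V p)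
      = mvfderiv 𝓘(ℝ, F) (fun q => mvfderiv 𝓘(ℝ, F) f q (V q)) p (U p)
        - mvfderiv 𝓘(ℝ, F) (fun q => mvfderiv 𝓘(ℝ, F) f q (U q)) p (V p) := by
  have hd : ∀ q, MDifferentiableAt 𝓘(ℝ, F) 𝓘(ℝ, N) f q := hf.mdifferentiable (by simp)
  have hc : ContDiffAt ℝ ∞ (f ∘ (extChartAt 𝓘(ℝ, F) p).symm) (extChartAt 𝓘(ℝ, F) p p) := by
    have h := (contMDiffAt_iff.1 (hf p)).2
    rw [modelWithCornersSelf_coe, Set.range_id] at h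
    exact h
  have hn : ∀ W : Π q : M, TangentSpace 𝓘(ℝ, F) q,
      ((fun q => mvfderiv 𝓘(ℝ, F) f q (W q)) ∘ (extChartAt 𝓘(ℝ, F) p).symm)
        =ᶠ[𝓝 (extChartAt 𝓘(ℝ, F) p p)]
      fun y => fderiv ℝ (f ∘ (extChartAt 𝓘(ℝ, F) p).symm) y (coordField p W y) := by
    intro W
    filter_upwards [extChartAt_target_mem_nhds (I := 𝓘(ℝ, F)) p] with y hy
    exact mvfderiv_apply_extChartAt_symm hy (hd _) W
  have hn2 : minSmoothness ℝ 2 ≤ (∞ : WithTop ℕ∞) := by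
    rw [minSmoothness_of_isRCLikeNormedField]
    exact ENat.LEInfty.out
  have key := fderiv_apply_lieBracket hc hn2 (differentiableAt_coordField hV)
    (differentiableAt_coordField hU)
  rw [← (hn U).fderiv_eq, ← (hn V).fderiv_eq, coordField_self, coordField_self] at key
  rw [mvfderiv_eq_fderiv_self (hd p), mvfderiv_eq_fderiv_self hUf, mvfderiv_eq_fderiv_self hVf]
  exact (congrArg _ (mlieBracket_eq_lieBracket p U V)).trans key

end Coordinates

/-! ### Smooth 2-forms and the Poisson structure of a symplectic form -/

section Forms

open VectorField Filter Topology

variable {F : Type*} [NormedAddCommGroup F] [NormedSpace ℝ F]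
  {M : Type*} [TopologicalSpace M] [ChartedSpace F M] [IsManifold 𝓘(ℝ, F) ∞ M]
  {N : Type*} [NormedAddCommGroup N] [NormedSpace ℝ N]

/-- The frame of the tangent bundle near `p` given by the chart at `p`, as a map from the model
space to the tangent space at `q`. -/
def frame (p q : M) : F →L[ℝ] TangentSpace 𝓘(ℝ, F) q :=
  (trivializationAt F (TangentSpace 𝓘(ℝ, F)) p).symmL ℝ q

/-- The matrix of a bilinear form on `T_q M` in the frame given by the chart at `p`. -/
def formInFrame (p q : M)
    (B : TangentSpace 𝓘(ℝ, F) q →L[ℝ] TangentSpace 𝓘(ℝ, F) q →L[ℝ] ℝ) : F →L[ℝ] F →L[ℝ] ℝ :=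
  ContinuousLinearMap.bilinearComp (E := F) (F := F) B (frame p q) (frame p q)

/-- A field of bilinear forms is smooth if and only if its matrix in the coordinate frames is. -/
lemma contMDiffAt_form_iff
    (B : Π q : M, TangentSpace 𝓘(ℝ, F) q →L[ℝ] TangentSpace 𝓘(ℝ, F) q →L[ℝ] ℝ) (p : M) :
    ContMDiffAt 𝓘(ℝ, F) (𝓘(ℝ, F).prod 𝓘(ℝ, F →L[ℝ] F →L[ℝ] ℝ)) ∞
    (fun p => Bundle.TotalSpace.mk' (F →L[ℝ] F →L[ℝ] ℝ)
      (E := fun p : M => TangentSpace 𝓘(ℝ, F) p →L[ℝ] TangentSpace 𝓘(ℝ, F) p →L[ℝ] ℝ)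
      p (B p)) p ↔
    ContMDiffAt 𝓘(ℝ, F) 𝓘(ℝ, F →L[ℝ] F →L[ℝ] ℝ) ∞ (fun q => formInFrame p q (B q)) p := by
  rw [contMDiffAt_hom_bundle]
  have h : (fun q => ContinuousLinearMap.inCoordinates F (TangentSpace 𝓘(ℝ, F)) (F →L[ℝ] ℝ)
      (fun q : M => TangentSpace 𝓘(ℝ, F) q →L[ℝ] ℝ) p q p q (B q))
      =ᶠ[𝓝 p] fun q => formInFrame p q (B q) := by
    filter_upwards [(trivializationAt F (TangentSpace 𝓘(ℝ, F)) p).open_baseSet.mem_nhds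
      (FiberBundle.mem_baseSet_trivializationAt' p)] with q hq
    ext u v
    have h1 := inCoordinates_apply_eq₂ (𝕜 := ℝ) (F₁ := F) (F₂ := F) (F₃ := ℝ)
      (E₁ := TangentSpace 𝓘(ℝ, F)) (E₂ := TangentSpace 𝓘(ℝ, F)) (E₃ := Bundle.Trivial M ℝ)
      (ϕ := B q) (v := u) (w := v) hq hq (Set.mem_univ q)
    rw [← Bundle.Trivialization.symmL_apply (R := ℝ) _ hq,
      ← Bundle.Trivialization.symmL_apply (R := ℝ) _ hq] at h1
    exact h1.trans (LinearMap.congr_fun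
      (Bundle.Trivial.linearMapAt_trivialization ℝ M ℝ q) (formInFrame p q (B q) u v))
  constructor
  · intro H
    exact H.2.congr_of_eventuallyEq h.symm
  · intro H
    exact ⟨contMDiffAt_id, H.congr_of_eventuallyEq h⟩

lemma contMDiffAt_mvfderiv_frame {f : M → N} (hf : ContMDiff 𝓘(ℝ, F) 𝓘(ℝ, N) ∞ f) (p : M) :
    ContMDiffAt 𝓘(ℝ, F) 𝓘(ℝ, F →L[ℝ] N) ∞
      (fun q => (mvfderiv 𝓘(ℝ, F) f q).comp (frame p q)) p := by
  have h := (hf p).mfderiv_const (m := ∞) (by simp)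
  refine h.congr_of_eventuallyEq ?_
  filter_upwards [(trivializationAt F (TangentSpace 𝓘(ℝ, F)) p).open_baseSet.mem_nhds
      (FiberBundle.mem_baseSet_trivializationAt' p)] with q hq
  rw [TangentBundle.trivializationAt_baseSet] at hq
  have hI : IsManifold 𝓘(ℝ, F) 1 M := IsManifold.of_le (n := ∞) (by simp)
  have h1 := inTangentCoordinates_eq_mfderiv_comp (I := 𝓘(ℝ, F)) (I' := 𝓘(ℝ, N)) (f := id) (g := f)
    (ϕ := fun q => mfderiv 𝓘(ℝ, F) 𝓘(ℝ, N) f q) (x₀ := p) (x := q) hq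
    (by rw [chartAt_self_eq]; trivial)
  have h2 : ∀ y z : N, (mfderiv 𝓘(ℝ, N) 𝓘(ℝ, N) (extChartAt 𝓘(ℝ, N) z) y : N →L[ℝ] N)
      = ContinuousLinearMap.id ℝ N := fun y z => by
    rw [extChartAt_model_space_eq_id]
    exact mfderiv_id
  have h3 := TangentBundle.symmL_trivializationAt (𝕜 := ℝ) (I := 𝓘(ℝ, F)) hq
  refine ContinuousLinearMap.ext fun u => ?_
  have h4 := congrArg (fun L : F →L[ℝ] F => (mvfderiv 𝓘(ℝ, F) f q : F →L[ℝ] N) (L u)) h3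
  have h5 := congrArg (fun L : F →L[ℝ] N => L u) h1
  refine h4.trans (Eq.trans ?_ h5.symm)
  exact (congrArg (fun L : N →L[ℝ] N => L _) (h2 (f q) (f p))).symm

lemma contMDiff_mvfderiv_apply {f : M → N} (hf : ContMDiff 𝓘(ℝ, F) 𝓘(ℝ, N) ∞ f)
    {V : Π q : M, TangentSpace 𝓘(ℝ, F) q} (hV : SmoothField V) :
    ContMDiff 𝓘(ℝ, F) 𝓘(ℝ, N) ∞ (fun q => mvfderiv 𝓘(ℝ, F) f q (V q)) := by
  have h := ((hf.contMDiff_tangentMap (m := ∞) (by simp)).comp hV)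
  have h2 := (contMDiff_snd_tangentBundle_modelSpace N 𝓘(ℝ, N) (n := ∞)).comp h
  exact h2

lemma contMDiff_form_apply
    {B : Π q : M, TangentSpace 𝓘(ℝ, F) q →L[ℝ] TangentSpace 𝓘(ℝ, F) q →L[ℝ] ℝ}
    (hB : ContMDiff 𝓘(ℝ, F) (𝓘(ℝ, F).prod 𝓘(ℝ, F →L[ℝ] F →L[ℝ] ℝ)) ∞
      (fun p => Bundle.TotalSpace.mk' (F →L[ℝ] F →L[ℝ] ℝ)
      (E := fun p : M => TangentSpace 𝓘(ℝ, F) p →L[ℝ] TangentSpace 𝓘(ℝ, F) p →L[ℝ] ℝ)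
      p (B p)))
    {U V : Π q : M, TangentSpace 𝓘(ℝ, F) q} (hU : SmoothField U) (hV : SmoothField V) :
    ContMDiff 𝓘(ℝ, F) 𝓘(ℝ, ℝ) ∞ (fun q => B q (U q) (V q)) := by
  have h := ContMDiff.clm_bundle_apply₂ (F₁ := F) (F₂ := F) (F₃ := ℝ)
    (E₁ := TangentSpace 𝓘(ℝ, F)) (E₂ := TangentSpace 𝓘(ℝ, F)) (E₃ := Bundle.Trivial M ℝ)
    (b := id) hB hU hV
  intro p
  exact ((Bundle.contMDiffAt_totalSpace).1 (h p)).2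

end Forms

namespace SymplecticForm

open VectorField Filter Topology

variable {F : Type*} [NormedAddCommGroup F] [NormedSpace ℝ F]
  {M : Type*} [TopologicalSpace M] [ChartedSpace F M] [IsManifold 𝓘(ℝ, F) ∞ M]
  (Ω : SymplecticForm F M)

lemma form_swap (p : M) (u v : TangentSpace 𝓘(ℝ, F) p) : Ω.form p u v = -Ω.form p v u := by
  have h := Ω.alt p (u + v)
  simp only [map_add, add_apply, Ω.alt p, zero_add, add_zero] at h
  linarith

variable [FiniteDimensional ℝ F]

lemma poisson_apply (p : M) (α β : Module.Dual ℝ (TangentSpace 𝓘(ℝ, F) p)) :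
    Ω.poisson p α β = β ((Ω.flat p).symm α) := rfl

/-- The Hamiltonian vector field of `f`: the vector field `X_f` with `ι_{X_f} Ω = df`. -/
def hamiltonian (f : M → ℝ) (p : M) : TangentSpace 𝓘(ℝ, F) p :=
  (Ω.flat p).symm (differential f p)

lemma form_hamiltonian (f : M → ℝ) (p : M) (v : TangentSpace 𝓘(ℝ, F) p) :
    Ω.form p (Ω.hamiltonian f p) v = mvfderiv 𝓘(ℝ, F) f p v := by
  rw [← flat_apply, hamiltonian, LinearEquiv.apply_symm_apply]
  rfl

lemma bracket_apply (f g : M → ℝ) (p : M) :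
    bivectorBracket Ω.poisson f g p = mvfderiv 𝓘(ℝ, F) g p (Ω.hamiltonian f p) := rfl

/-- In the coordinate frames the matrix of `Ω` is invertible and depends smoothly on the point,
hence so does its inverse. -/
lemma smooth_hamiltonian {f : M → ℝ} (hf : ContMDiff 𝓘(ℝ, F) 𝓘(ℝ, ℝ) ∞ f) :
    SmoothField (Ω.hamiltonian f) := by
  intro p
  have hb := (trivializationAt F (TangentSpace 𝓘(ℝ, F)) p).open_baseSet.mem_nhds
      (FiberBundle.mem_baseSet_trivializationAt' p)
  refine (Bundle.contMDiffAt_section (F := F) (E := TangentSpace 𝓘(ℝ, F)) p).2 ?_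
  have hΩ := (contMDiffAt_form_iff Ω.form p).1 (Ω.smooth p)
  have hdf := contMDiffAt_mvfderiv_frame hf p
  have hinj : ∀ q ∈ (trivializationAt F (TangentSpace 𝓘(ℝ, F)) p).baseSet,
      Function.Injective (formInFrame p q (Ω.form q)) := by
    intro q hq
    refine (injective_iff_map_eq_zero _).2 fun u hu => ?_
    have h0 : frame p q u = 0 := Ω.nondeg q _ fun v => by
      have h1 := congrArg (fun L : F →L[ℝ] ℝ => L
        ((trivializationAt F (TangentSpace 𝓘(ℝ, F)) p).continuousLinearMapAt ℝ q v)) hu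
      have h2 : frame p q ((trivializationAt F (TangentSpace 𝓘(ℝ, F)) p).continuousLinearMapAt
          ℝ q v) = v := Bundle.Trivialization.symmL_continuousLinearMapAt _ hq v
      refine (congrArg (Ω.form q (frame p q u)) h2).symm.trans h1
    have h3 := Bundle.Trivialization.continuousLinearMapAt_symmL (R := ℝ)
      (trivializationAt F (TangentSpace 𝓘(ℝ, F)) p) hq u
    rw [← h3]
    exact (congrArg _ h0).trans (map_zero _)
  have hfin : Module.finrank ℝ F = Module.finrank ℝ (F →L[ℝ] ℝ) := by
    rw [← (LinearMap.toContinuousLinearMap (𝕜 := ℝ) (E := F) (F' := ℝ)).finrank_eq,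
      Subspace.dual_finrank_eq]
  have hequiv : ∀ q ∈ (trivializationAt F (TangentSpace 𝓘(ℝ, F)) p).baseSet,
      ∃ e : F ≃L[ℝ] (F →L[ℝ] ℝ), (e : F →L[ℝ] F →L[ℝ] ℝ) = formInFrame p q (Ω.form q) :=
    fun q hq => ⟨(LinearEquiv.ofInjectiveOfFinrankEq (formInFrame p q (Ω.form q)).toLinearMap
      (hinj q hq) hfin).toContinuousLinearEquiv, by ext; rfl⟩
  have hsm : ContMDiffAt 𝓘(ℝ, F) 𝓘(ℝ, F) ∞ (fun q => (formInFrame p q (Ω.form q)).inverse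
      ((mvfderiv 𝓘(ℝ, F) f q).comp (frame p q))) p := by
    obtain ⟨e, he⟩ := hequiv p (FiberBundle.mem_baseSet_trivializationAt' p)
    have hi : ContDiffAt ℝ ∞ ContinuousLinearMap.inverse (formInFrame p p (Ω.form p)) := by
      rw [← he]
      exact contDiffAt_map_inverse e
    exact (hi.contMDiffAt.comp p hΩ).clm_apply hdf
  refine hsm.congr_of_eventuallyEq ?_
  filter_upwards [hb] with q hq
  obtain ⟨e, he⟩ := hequiv q hq
  rw [← he, ContinuousLinearMap.inverse_equiv]
  refine (e.eq_symm_apply).2 ?_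
  ext u
  have h3 : frame p q ((trivializationAt F (TangentSpace 𝓘(ℝ, F)) p ⟨q, Ω.hamiltonian f q⟩).2)
      = Ω.hamiltonian f q :=
    (Bundle.Trivialization.symmL_apply _ hq _).trans
      (Bundle.Trivialization.symm_apply_apply_mk _ hq _)
  have h4 := congrArg (fun L : F →L[ℝ] F →L[ℝ] ℝ => L
    ((trivializationAt F (TangentSpace 𝓘(ℝ, F)) p ⟨q, Ω.hamiltonian f q⟩).2) u) he
  refine h4.trans ?_
  have h5 := congrArg (fun v => Ω.form q v (frame p q u)) h3
  exact h5.trans (Ω.form_hamiltonian f q _)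

/-- The Jacobi identity of the bracket is the closedness of `Ω`, evaluated on Hamiltonian
vector fields. -/
theorem isPoisson_poisson : IsPoisson Ω.poisson where
  alt p α := by
    obtain ⟨v, rfl⟩ := (Ω.flat p).surjective α
    rw [poisson_apply, LinearEquiv.symm_apply_apply, flat_apply]
    exact Ω.alt p v
  smooth f g hf hg := contMDiff_mvfderiv_apply hg (Ω.smooth_hamiltonian hf)
  jacobi f g h hf hg hh p := by
    have hsm : ∀ a b : M → ℝ, ContMDiff 𝓘(ℝ, F) 𝓘(ℝ, ℝ) ∞ a → ContMDiff 𝓘(ℝ, F) 𝓘(ℝ, ℝ) ∞ b →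
        MDifferentiableAt 𝓘(ℝ, F) 𝓘(ℝ, ℝ) (bivectorBracket Ω.poisson a b) p := fun a b ha hb =>
      (contMDiff_mvfderiv_apply hb (Ω.smooth_hamiltonian ha)).mdifferentiable (by simp) p
    have hanti : ∀ a b : M → ℝ, bivectorBracket Ω.poisson a b
        = -bivectorBracket Ω.poisson b a := fun a b => funext fun q => by
      rw [Pi.neg_apply, bracket_apply, bracket_apply, ← form_hamiltonian, ← form_hamiltonian,
        form_swap]
    have hform : ∀ a b : M → ℝ, (fun q => Ω.form q (Ω.hamiltonian a q) (Ω.hamiltonian b q))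
        = bivectorBracket Ω.poisson b a := fun a b => funext fun q => by
      rw [form_hamiltonian, bracket_apply]
    have hneg : ∀ a b c : M → ℝ, bivectorBracket Ω.poisson a (bivectorBracket Ω.poisson b c) p
        = -bivectorBracket Ω.poisson a (bivectorBracket Ω.poisson c b) p := fun a b c => by
      rw [hanti b c, bracket_apply, bracket_apply, mvfderiv_neg]; rfl
    have hlie : ∀ a b c : M → ℝ, ContMDiff 𝓘(ℝ, F) 𝓘(ℝ, ℝ) ∞ a →
        ContMDiff 𝓘(ℝ, F) 𝓘(ℝ, ℝ) ∞ b → ContMDiff 𝓘(ℝ, F) 𝓘(ℝ, ℝ) ∞ c →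
        Ω.form p (mlieBracket 𝓘(ℝ, F) (Ω.hamiltonian a) (Ω.hamiltonian b) p) (Ω.hamiltonian c p)
        = bivectorBracket Ω.poisson b (bivectorBracket Ω.poisson a c) p
          - bivectorBracket Ω.poisson a (bivectorBracket Ω.poisson b c) p :=
      fun a b c ha hb hc => by
        have := FiniteDimensional.complete ℝ F
        have key := mvfderiv_mlieBracket hc ((Ω.smooth_hamiltonian ha).mdifferentiableAt p)
          ((Ω.smooth_hamiltonian hb).mdifferentiableAt p) (hsm a c ha hc) (hsm b c hb hc)
        rw [form_swap, form_hamiltonian, key, neg_sub]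
        rfl
    have hcl := Ω.closed _ _ _ (Ω.smooth_hamiltonian hf) (Ω.smooth_hamiltonian hg)
      (Ω.smooth_hamiltonian hh) p
    rw [dTwoForm, hform, hform, hform, hlie f g h hf hg hh, hlie f h g hf hh hg,
      hlie g h f hg hh hf, ← bracket_apply, ← bracket_apply, ← bracket_apply] at hcl
    have e1 := hneg f g h
    have e2 := hneg g f h
    have e3 := hneg h f g
    linarith

lemma poisson_nondegenerate (p : M) : (Ω.poisson p).Nondegenerate := by
  have hr : (Ω.poisson p).IsRefl :=
    LinearMap.IsAlt.isRefl (B := Ω.poisson p) (Ω.isPoisson_poisson.alt p)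
  refine hr.nondegenerate_iff_separatingLeft.2 fun α hα => ?_
  have h : (Ω.flat p).symm α = 0 :=
    (Module.forall_dual_apply_eq_zero_iff ℝ _).1 fun β => hα β
  simpa using h

lemma poisson_injective {Ω Ω' : SymplecticForm F M} (h : Ω.poisson = Ω'.poisson) : Ω = Ω' := by
  have hf : Ω.form = Ω'.form := by
    funext p
    have h1 : ∀ α, (Ω.flat p).symm α = (Ω'.flat p).symm α := fun α => by
      rw [← sub_eq_zero]
      refine (Module.forall_dual_apply_eq_zero_iff ℝ _).1 fun β => ?_
      rw [map_sub, sub_eq_zero]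
      exact LinearMap.congr_fun₂ (congrFun h p) α β
    ext u v
    rw [← flat_apply, ← flat_apply]
    have h2 : Ω.flat p u = Ω'.flat p u := by
      rw [← LinearEquiv.symm_apply_eq, ← h1, LinearEquiv.symm_apply_apply]
    rw [h2]
  cases Ω; cases Ω'; cases hf; rfl

end SymplecticForm

/-! ### The derivative of the adjoint action -/

section AdjointDerivative

open VectorField Filter Topology

section Partial

variable {E N : Type*} [NormedAddCommGroup E] [NormedSpace ℝ E]
  [NormedAddCommGroup N] [NormedSpace ℝ N]

lemma fderiv_partial_right {Φ : E × E → N} {x y : E} (h : DifferentiableAt ℝ Φ (x, y)) :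
    fderiv ℝ (fun z => Φ (x, z)) y = (fderiv ℝ Φ (x, y)).comp (ContinuousLinearMap.inr ℝ E E) :=
  (h.hasFDerivAt.comp y (hasFDerivAt_prodMk_right x y)).fderiv

lemma fderiv_partial_left {Φ : E × E → N} {x y : E} (h : DifferentiableAt ℝ Φ (x, y)) :
    fderiv ℝ (fun z => Φ (z, y)) x = (fderiv ℝ Φ (x, y)).comp (ContinuousLinearMap.inl ℝ E E) :=
  (h.hasFDerivAt.comp x (hasFDerivAt_prodMk_left x y)).fderiv

lemma hasFDerivAt_comp_const {Ψ : E → E × E →L[ℝ] N} {Ψ' : E →L[ℝ] E × E →L[ℝ] N} {x : E}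
    (h : HasFDerivAt Ψ Ψ' x) (c : E →L[ℝ] E × E) :
    HasFDerivAt (fun y => (Ψ y).comp c) (((ContinuousLinearMap.compL ℝ E (E × E) N).flip c).comp Ψ')
      x :=
  ((ContinuousLinearMap.compL ℝ E (E × E) N).flip c).hasFDerivAt.comp x h

lemma hasFDerivAt_ringInverse_mul {A : Type*} [NormedRing A] [NormedAlgebra ℝ A]
    [CompleteSpace A] {J K : E → A} {J' K' : E →L[ℝ] A} {x : E} (hJ : HasFDerivAt J J' x)
    (hK : HasFDerivAt K K' x) (hJ1 : J x = 1) (hK1 : K x = 1) :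
    HasFDerivAt (fun y => Ring.inverse (J y) * K y) (K' - J') x := by
  have h := hasFDerivAt_ringInverse (𝕜 := ℝ) (1 : Aˣ)
  rw [Units.val_one, ← hJ1] at h
  refine ((h.comp x hJ).mul' hK).congr_fderiv ?_
  ext v
  simp [hJ1, hK1, sub_eq_add_neg]

end Partial

variable {E : Type*} [NormedAddCommGroup E] [NormedSpace ℝ E]
  {G : Type*} [TopologicalSpace G] [ChartedSpace E G] [Group G]

variable (E G) in
/-- The multiplication of `G` in the chart at the identity. -/
def mulChart (z : E × E) : E :=
  extChartAt 𝓘(ℝ, E) (1 : G)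
    ((extChartAt 𝓘(ℝ, E) (1 : G)).symm z.1 * (extChartAt 𝓘(ℝ, E) (1 : G)).symm z.2)

variable (E) in
/-- The adjoint action, as a family of endomorphisms of the model space `E = T_1 G`. -/
def adModel (g : G) : E →L[ℝ] E := Ad E g

variable [LieGroup 𝓘(ℝ, E) ∞ G]

lemma contDiffAt_mulChart : ContDiffAt ℝ ∞ (mulChart E G)
    (extChartAt 𝓘(ℝ, E) (1 : G) 1, extChartAt 𝓘(ℝ, E) (1 : G) 1) := by
  have hs : ContMDiffAt 𝓘(ℝ, E) 𝓘(ℝ, E) ∞ (extChartAt 𝓘(ℝ, E) (1 : G)).symm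
      (extChartAt 𝓘(ℝ, E) (1 : G) 1) :=
    (contMDiffOn_extChartAt_symm (1 : G)).contMDiffAt (extChartAt_target_mem_nhds (1 : G))
  have h1 : ContMDiffAt 𝓘(ℝ, E × E) 𝓘(ℝ, E) ∞ (fun z : E × E =>
      (extChartAt 𝓘(ℝ, E) (1 : G)).symm z.1)
      (extChartAt 𝓘(ℝ, E) (1 : G) 1, extChartAt 𝓘(ℝ, E) (1 : G) 1) :=
    ContMDiffAt.comp (x := (extChartAt 𝓘(ℝ, E) (1 : G) 1, extChartAt 𝓘(ℝ, E) (1 : G) 1)) hs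
      contDiff_fst.contMDiff.contMDiffAt
  have h2 : ContMDiffAt 𝓘(ℝ, E × E) 𝓘(ℝ, E) ∞ (fun z : E × E =>
      (extChartAt 𝓘(ℝ, E) (1 : G)).symm z.2)
      (extChartAt 𝓘(ℝ, E) (1 : G) 1, extChartAt 𝓘(ℝ, E) (1 : G) 1) :=
    ContMDiffAt.comp (x := (extChartAt 𝓘(ℝ, E) (1 : G) 1, extChartAt 𝓘(ℝ, E) (1 : G) 1)) hs
      contDiff_snd.contMDiff.contMDiffAt
  have h3 := h1.mul h2
  have h4 : ContMDiffAt 𝓘(ℝ, E) 𝓘(ℝ, E) ∞ (extChartAt 𝓘(ℝ, E) (1 : G))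
      ((extChartAt 𝓘(ℝ, E) (1 : G)).symm (extChartAt 𝓘(ℝ, E) (1 : G) 1)
        * (extChartAt 𝓘(ℝ, E) (1 : G)).symm (extChartAt 𝓘(ℝ, E) (1 : G) 1)) := by
    rw [extChartAt_to_inv, one_mul]
    exact contMDiffAt_extChartAt
  exact (h4.comp (extChartAt 𝓘(ℝ, E) (1 : G) 1, extChartAt 𝓘(ℝ, E) (1 : G) 1) h3).contDiffAt

lemma mfderiv_extChartAt_one {q : G} (hq : q = 1) (v : E) :
    (mfderiv 𝓘(ℝ, E) 𝓘(ℝ, E) (extChartAt 𝓘(ℝ, E) (1 : G)) q : E →L[ℝ] E) v = v := by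
  have hI : IsManifold 𝓘(ℝ, E) 1 G := IsManifold.of_le (n := ∞) (by simp)
  subst hq
  rw [mfderiv_extChartAt_self]; rfl

/-- If `f : G → G` maps `1` into the source of the chart at the identity, then the derivative of
`f` at `1`, followed by the chart, is the derivative of `f` in coordinates. -/
lemma mfderiv_extChartAt_mfderiv {f : G → G} (hf : MDifferentiableAt 𝓘(ℝ, E) 𝓘(ℝ, E) f 1)
    (h1 : f 1 ∈ (extChartAt 𝓘(ℝ, E) (1 : G)).source) (v : E) :
    (mfderiv 𝓘(ℝ, E) 𝓘(ℝ, E) (extChartAt 𝓘(ℝ, E) (1 : G)) (f 1) : E →L[ℝ] E)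
      ((mfderiv 𝓘(ℝ, E) 𝓘(ℝ, E) f 1 : E →L[ℝ] E) v)
      = fderiv ℝ (fun y => extChartAt 𝓘(ℝ, E) (1 : G) (f ((extChartAt 𝓘(ℝ, E) (1 : G)).symm y)))
        (extChartAt 𝓘(ℝ, E) (1 : G) 1) v := by
  have hI : IsManifold 𝓘(ℝ, E) 1 G := IsManifold.of_le (n := ∞) (by simp)
  have hφ : MDifferentiableAt 𝓘(ℝ, E) 𝓘(ℝ, E) (extChartAt 𝓘(ℝ, E) (1 : G)) (f 1) :=
    mdifferentiableAt_extChartAt (by rwa [extChartAt_source] at h1)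
  have h2 := mvfderiv_eq_fderiv_self (hφ.comp 1 hf) v
  refine Eq.trans ?_ h2
  exact (mfderiv_comp_apply (I' := 𝓘(ℝ, E)) (1 : G) hφ hf v).symm

lemma coordField_mulInvariantVectorField {x : E}
    (hx : x ∈ (extChartAt 𝓘(ℝ, E) (1 : G)).target) (Z : GroupLieAlgebra 𝓘(ℝ, E) G) :
    coordField (1 : G) (mulInvariantVectorField Z) x
      = fderiv ℝ (fun y => mulChart E G (x, y)) (extChartAt 𝓘(ℝ, E) (1 : G) 1) Z := by
  have hm : MDifferentiableAt 𝓘(ℝ, E) 𝓘(ℝ, E)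
      (fun h : G => (extChartAt 𝓘(ℝ, E) (1 : G)).symm x * h) 1 :=
    (contMDiff_mul_left (n := ∞)).mdifferentiable (by simp) 1
  have hs := (extChartAt 𝓘(ℝ, E) (1 : G)).map_target hx
  have h := mfderiv_extChartAt_mfderiv hm (by rwa [mul_one]) Z
  rw [coordField_eq_mfderiv hx]
  refine Eq.trans ?_ h
  have hg : ∀ q : G, q = (extChartAt 𝓘(ℝ, E) (1 : G)).symm x → ∀ v : E,
      (mfderiv 𝓘(ℝ, E) 𝓘(ℝ, E) (extChartAt 𝓘(ℝ, E) (1 : G))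
        ((extChartAt 𝓘(ℝ, E) (1 : G)).symm x) : E →L[ℝ] E) v
      = (mfderiv 𝓘(ℝ, E) 𝓘(ℝ, E) (extChartAt 𝓘(ℝ, E) (1 : G)) q : E →L[ℝ] E) v := by
    rintro _ rfl v; rfl
  exact hg _ (mul_one _) _

/-- Differentiating `g h = (g h g⁻¹) g` in `h` at the identity. -/
lemma fderiv_mulChart_conj {x : E}
    (hd : DifferentiableAt ℝ (mulChart E G) (extChartAt 𝓘(ℝ, E) (1 : G) 1, x)) (Z : E) :
    fderiv ℝ (fun y => mulChart E G (x, y)) (extChartAt 𝓘(ℝ, E) (1 : G) 1) Z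
      = fderiv ℝ (fun y => mulChart E G (y, x)) (extChartAt 𝓘(ℝ, E) (1 : G) 1)
        (adModel E ((extChartAt 𝓘(ℝ, E) (1 : G)).symm x) Z) := by
  have hI : IsManifold 𝓘(ℝ, E) 1 G := IsManifold.of_le (n := ∞) (by simp)
  set φ := extChartAt 𝓘(ℝ, E) (1 : G) with hφ
  set g : G := φ.symm x with hg
  have hcs := conj_smooth E g
  have h1 : g * 1 * g⁻¹ = 1 := by simp
  have hc : ∀ᶠ y in 𝓝 (φ 1), g * φ.symm y * g⁻¹ ∈ φ.source := by
    have hcont : ContinuousAt (fun y => g * φ.symm y * g⁻¹) (φ 1) :=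
      (hcs.continuous.continuousAt).comp (continuousAt_extChartAt_symm (I := 𝓘(ℝ, E)) (1 : G))
    refine hcont.preimage_mem_nhds ?_
    rw [extChartAt_to_inv, h1]
    exact extChartAt_source_mem_nhds (1 : G)
  have he : (fun y => mulChart E G (x, y)) =ᶠ[𝓝 (φ 1)]
      (fun y => mulChart E G (y, x)) ∘ fun y => φ (g * φ.symm y * g⁻¹) := by
    filter_upwards [hc] with y hy
    simp only [mulChart, Function.comp_apply, ← hφ, ← hg]
    rw [φ.left_inv hy]
    simp
  have hmd : MDifferentiableAt 𝓘(ℝ, E) 𝓘(ℝ, E) (fun h : G => g * h * g⁻¹) 1 :=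
    hcs.mdifferentiable (by simp) 1
  have hφ1 : g * 1 * g⁻¹ ∈ φ.source := by rw [h1]; exact mem_extChartAt_source _
  have hA := (mfderiv_extChartAt_one h1 _).symm.trans (mfderiv_extChartAt_mfderiv hmd hφ1 Z)
  have hcd : DifferentiableAt ℝ (fun y => φ (g * φ.symm y * g⁻¹)) (φ 1) := by
    have h2 : MDifferentiableAt 𝓘(ℝ, E) 𝓘(ℝ, E) (fun h : G => φ (g * h * g⁻¹)) (φ.symm (φ 1)) := by
      rw [extChartAt_to_inv]
      exact MDifferentiableAt.comp (1 : G)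
        (mdifferentiableAt_extChartAt (by rwa [hφ, extChartAt_source] at hφ1)) hmd
    exact comp_extChartAt_symm_differentiableAt (mem_extChartAt_target (1 : G)) h2
  have hc1 : φ (g * φ.symm (φ 1) * g⁻¹) = φ 1 := by rw [extChartAt_to_inv, h1]
  have hd' : DifferentiableAt ℝ (fun y => mulChart E G (y, x)) (φ (g * φ.symm (φ 1) * g⁻¹)) := by
    rw [hc1]
    exact DifferentiableAt.comp (g := mulChart E G) (f := fun y => (y, x)) (φ 1) hd
      (hasFDerivAt_prodMk_left (𝕜 := ℝ) (φ 1) x).differentiableAt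
  rw [he.fderiv_eq, fderiv_comp (g := fun y => mulChart E G (y, x))
    (f := fun y => φ (g * φ.symm y * g⁻¹)) (φ 1) hd' hcd, hc1]
  exact congrArg (fderiv ℝ (fun y => mulChart E G (y, x)) (φ 1)) hA.symm

/-- The derivative at the identity of `g ↦ Ad_{g⁻¹}` is `X ↦ -⁅X, ·⁆`. In the chart at the identity,
with multiplication `m`, one has `Ad_g = (∂₁ m(1, g))⁻¹ ∘ ∂₂ m(g, 1)`, while the left-invariant
field of `Z` is `g ↦ ∂₂ m(g, 1) Z`; both derivatives are then expressed by the second derivative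
of `m` at the identity. -/
lemma exists_hasMFDerivAt_Ad_inv [CompleteSpace E] :
    ∃ L : E →L[ℝ] E →L[ℝ] E,
      (∀ X Z : GroupLieAlgebra 𝓘(ℝ, E) G, L X Z = -⁅X, Z⁆) ∧
      HasMFDerivAt 𝓘(ℝ, E) 𝓘(ℝ, E →L[ℝ] E) (fun g : G => adModel E g⁻¹) 1 L := by
  have hI : IsManifold 𝓘(ℝ, E) 1 G := IsManifold.of_le (n := ∞) (by simp)
  set φ := extChartAt 𝓘(ℝ, E) (1 : G) with hφ
  set m := mulChart E G with hm
  have hcd : ContDiffAt ℝ ∞ m (φ 1, φ 1) := contDiffAt_mulChart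
  have hev : ∀ᶠ z in 𝓝 (φ 1, φ 1), DifferentiableAt ℝ m z := by
    filter_upwards [(hcd.of_le (m := 1) (by simp)).eventually (by simp)] with z hz
    exact hz.differentiableAt (by simp)
  have h2 : DifferentiableAt ℝ (fderiv ℝ m) (φ 1, φ 1) :=
    (hcd.fderiv_right (m := 1) (by rw [one_add_one_eq_two]; exact ENat.LEInfty.out)
      ).differentiableAt (by simp)
  set D := fderiv ℝ (fderiv ℝ m) (φ 1, φ 1) with hD
  have hsymm : IsSymmSndFDerivAt ℝ m (φ 1, φ 1) := hcd.isSymmSndFDerivAt (by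
    rw [minSmoothness_of_isRCLikeNormedField]
    exact ENat.LEInfty.out)
  -- `J x = ∂₂ m (x, 1)` and `K x = ∂₁ m (1, x)`
  set J : E → E →L[ℝ] E := fun x => (fderiv ℝ m (x, φ 1)).comp (ContinuousLinearMap.inr ℝ E E)
    with hJ
  set K : E → E →L[ℝ] E := fun x => (fderiv ℝ m (φ 1, x)).comp (ContinuousLinearMap.inl ℝ E E)
    with hK
  have hx1 : Tendsto (fun x => (x, φ 1)) (𝓝 (φ 1)) (𝓝 (φ 1, φ 1)) :=
    (Continuous.prodMk_left (φ 1)).tendsto' _ _ rfl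
  have hx2 : Tendsto (fun x => (φ 1, x)) (𝓝 (φ 1)) (𝓝 (φ 1, φ 1)) :=
    (Continuous.prodMk_right (φ 1)).tendsto' _ _ rfl
  have htgt : ∀ᶠ x in 𝓝 (φ 1), x ∈ φ.target := extChartAt_target_mem_nhds (1 : G)
  have hJeq : ∀ᶠ x in 𝓝 (φ 1), fderiv ℝ (fun y => m (x, y)) (φ 1) = J x := by
    filter_upwards [hx1.eventually hev] with x hx using fderiv_partial_right hx
  have hKeq : ∀ᶠ x in 𝓝 (φ 1), fderiv ℝ (fun y => m (y, x)) (φ 1) = K x := by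
    filter_upwards [hx2.eventually hev] with x hx using fderiv_partial_left hx
  have hJd : HasFDerivAt J ((ContinuousLinearMap.compL ℝ E (E × E) E).flip
      (ContinuousLinearMap.inr ℝ E E) ∘L (D ∘L ContinuousLinearMap.inl ℝ E E)) (φ 1) :=
    hasFDerivAt_comp_const (HasFDerivAt.comp (g := fderiv ℝ m) (f := fun x => (x, φ 1)) (φ 1)
      h2.hasFDerivAt (hasFDerivAt_prodMk_left (φ 1) (φ 1))) _
  have hKd : HasFDerivAt K ((ContinuousLinearMap.compL ℝ E (E × E) E).flip
      (ContinuousLinearMap.inl ℝ E E) ∘L (D ∘L ContinuousLinearMap.inr ℝ E E)) (φ 1) :=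
    hasFDerivAt_comp_const (HasFDerivAt.comp (g := fderiv ℝ m) (f := fun x => (φ 1, x)) (φ 1)
      h2.hasFDerivAt (hasFDerivAt_prodMk_right (φ 1) (φ 1))) _
  have hJ1 : J (φ 1) = 1 := by
    rw [← hJeq.self_of_nhds]
    have h : (fun y => m (φ 1, y)) =ᶠ[𝓝 (φ 1)] id := by
      filter_upwards [htgt] with y hy
      simp only [hm, mulChart, ← hφ, id]
      rw [extChartAt_to_inv, one_mul, φ.right_inv hy]
    rw [h.fderiv_eq, fderiv_id]; rfl
  have hK1 : K (φ 1) = 1 := by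
    rw [← hKeq.self_of_nhds]
    have h : (fun y => m (y, φ 1)) =ᶠ[𝓝 (φ 1)] id := by
      filter_upwards [htgt] with y hy
      simp only [hm, mulChart, ← hφ, id]
      rw [extChartAt_to_inv, mul_one, φ.right_inv hy]
    rw [h.fderiv_eq, fderiv_id]; rfl
  have hunit : ∀ᶠ x in 𝓝 (φ 1), IsUnit (J x) := by
    have : ∀ᶠ T in 𝓝 (J (φ 1)), IsUnit T := by
      rw [hJ1]
      exact (Units.isOpen (R := E →L[ℝ] E)).mem_nhds isUnit_one
    exact hJd.continuousAt.eventually this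
  -- `Ad_{g⁻¹} = J⁻¹ K` near the identity
  have hB : ∀ᶠ x in 𝓝 (φ 1), adModel E (φ.symm x)⁻¹ = Ring.inverse (J x) * K x := by
    filter_upwards [htgt, hJeq, hKeq, hx2.eventually hev, hunit] with x hx hxJ hxK hxd hxu
    have h : J x = K x * adModel E (φ.symm x) := by
      ext Z
      rw [← hxJ, ← hxK]
      exact fderiv_mulChart_conj hxd Z
    have h' : adModel E (φ.symm x) * adModel E (φ.symm x)⁻¹ = 1 := by
      have h'' := Ad_mul E (φ.symm x) (φ.symm x)⁻¹
      rw [mul_inv_cancel, Ad_one] at h''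
      exact h''.symm
    have h3 : J x * adModel E (φ.symm x)⁻¹ = K x := by
      rw [h, mul_assoc, h', mul_one]
    rw [← h3, ← mul_assoc, Ring.inverse_mul_cancel _ hxu, one_mul]
  have hBd := (hasFDerivAt_ringInverse_mul hJd hKd hJ1 hK1).congr_of_eventuallyEq hB
  refine ⟨_, ?_, ?_, hBd.hasFDerivWithinAt⟩
  · intro X Z
    have hbr : ⁅X, Z⁆ = D (X, 0) (0, Z) - D (Z, 0) (0, X) := by
      have hZ : ∀ W : GroupLieAlgebra 𝓘(ℝ, E) G,
          coordField (1 : G) (mulInvariantVectorField W) =ᶠ[𝓝 (φ 1)] fun x => J x W := fun W => by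
        filter_upwards [htgt, hJeq] with x hx hxJ
        rw [coordField_mulInvariantVectorField hx, ← hxJ]
      have hJW : ∀ V W : E, fderiv ℝ (fun x => J x W) (φ 1) V = D (V, 0) (0, W) := fun V W => by
        rw [(hJd.clm_apply (hasFDerivAt_const W (φ 1))).fderiv]
        simp
      have hval : ∀ W : GroupLieAlgebra 𝓘(ℝ, E) G,
          coordField (1 : G) (mulInvariantVectorField W) (φ 1) = W := fun W =>
        (hZ W).self_of_nhds.trans (congrArg (fun T : E →L[ℝ] E => T W) hJ1)
      have hder : ∀ V W : GroupLieAlgebra 𝓘(ℝ, E) G,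
          fderiv ℝ (coordField (1 : G) (mulInvariantVectorField W)) (φ 1)
            (coordField (1 : G) (mulInvariantVectorField V) (φ 1)) = D (V, 0) (0, W) := fun V W =>
        (congrArg₂ (fun (T : E →L[ℝ] E) v => T v) (hZ W).fderiv_eq (hval V)).trans (hJW V W)
      rw [GroupLieAlgebra.bracket_def, mlieBracket_eq_lieBracket]
      exact congrArg₂ (fun a b : E => a - b) (hder X Z) (hder Z X)
    refine Eq.trans ?_ (congrArg Neg.neg hbr.symm)
    have hs : D (0, X) (Z, 0) = D (Z, 0) (0, X) := hsymm _ _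
    change D (0, X) (Z, 0) - D (X, 0) (0, Z) = -(D (X, 0) (0, Z) - D (Z, 0) (0, X) : E)
    rw [hs, neg_sub]
  · have hc := hBd.continuousAt
    have hc2 : ContinuousAt ((fun x => adModel E (φ.symm x)⁻¹) ∘ φ) 1 :=
      hc.comp (continuousAt_extChartAt (1 : G))
    refine hc2.congr ?_
    filter_upwards [extChartAt_source_mem_nhds (I := 𝓘(ℝ, E)) (1 : G)] with g hg
    simp only [Function.comp_apply]
    rw [φ.left_inv hg]

end AdjointDerivative

/-! ### The dressing action and the complement `𝔤*_t` -/

section Dressing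

variable {E : Type*} [NormedAddCommGroup E] [NormedSpace ℝ E] [CompleteSpace E]
  {G : Type*} [TopologicalSpace G] [ChartedSpace E G] [Group G] [LieGroup 𝓘(ℝ, E) ∞ G]

/-- The derivative at the identity of `g ↦ Ad*_g η` is `X ↦ -η ∘ ad X`. -/
lemma exists_hasMFDerivAt_coAd (η : CoLie E) :
    ∃ L : E →L[ℝ] CoLie E,
      (∀ X Z : GroupLieAlgebra 𝓘(ℝ, E) G, L X Z = -toForm E G η ⁅X, Z⁆) ∧
      HasMFDerivAt 𝓘(ℝ, E) 𝓘(ℝ, CoLie E) (fun g : G => coAd E g η) 1 L := by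
  obtain ⟨L, hL, hd⟩ := exists_hasMFDerivAt_Ad_inv (E := E) (G := G)
  refine ⟨(ContinuousLinearMap.compL ℝ E E ℝ η).comp L, fun X Z => ?_, ?_⟩
  · exact (congrArg η (hL X Z)).trans (map_neg η _)
  · exact ((ContinuousLinearMap.compL ℝ E E ℝ η).hasFDerivAt.hasMFDerivAt).comp (1 : G) hd

/-- The dressing vector field of `X + ξ` at `η` is `ξ - η ∘ ad X`. -/
lemma infDressing_apply (η : CoLie E) (x : Double E G) (Z : GroupLieAlgebra 𝓘(ℝ, E) G) :
    infDressing E η x Z = x.2 Z - toForm E G η ⁅x.1, Z⁆ := by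
  obtain ⟨L, hL, hd⟩ := exists_hasMFDerivAt_coAd (E := E) (G := G) η
  have h1 : HasMFDerivAt (𝓘(ℝ, E).prod 𝓘(ℝ, CoLie E)) 𝓘(ℝ, CoLie E)
      (fun d : G × CoLie E => coAd E d.1 η) (1, 0)
      (L.comp (ContinuousLinearMap.fst ℝ E (CoLie E))) :=
    HasMFDerivAt.comp (g := fun g : G => coAd E g η) (f := Prod.fst) ((1 : G), (0 : CoLie E)) hd
      (hasMFDerivAt_fst (I := 𝓘(ℝ, E)) (I' := 𝓘(ℝ, CoLie E)) ((1 : G), (0 : CoLie E)))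
  have h2 : HasMFDerivAt (𝓘(ℝ, E).prod 𝓘(ℝ, CoLie E)) 𝓘(ℝ, CoLie E)
      (fun d : G × CoLie E => d.2) (1, 0) (ContinuousLinearMap.snd ℝ E (CoLie E)) :=
    hasMFDerivAt_snd (I := 𝓘(ℝ, E)) (I' := 𝓘(ℝ, CoLie E)) ((1 : G), (0 : CoLie E))
  have h3 := (h2.add h1).mfderiv
  have h4 : infDressing E η x = x.2 + L x.1 :=
    congrArg (fun T : E × CoLie E →L[ℝ] CoLie E => T x) h3
  rw [h4, sub_eq_add_neg]
  exact congrArg (x.2 Z + ·) (hL x.1 Z)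

end Dressing

section CompleteTriple

variable {E : Type*} [NormedAddCommGroup E] [NormedSpace ℝ E]
  {G : Type*} [TopologicalSpace G] [ChartedSpace E G] [Group G]
  {t : ⋀[ℝ]^2 (GroupLieAlgebra 𝓘(ℝ, E) G)}

lemma mem_twistedComplement_iff {x : Double E G} :
    x ∈ twistedComplement E t ↔ x.1 = sharp t (toForm E G x.2) := by
  refine ⟨fun h => ?_, fun h η => ?_⟩
  · rw [← sub_eq_zero, ← Module.forall_dual_apply_eq_zero_iff ℝ]
    intro η
    rw [map_sub, apply_sharp, sub_eq_zero]
    exact h η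
  · rw [h, apply_sharp]

lemma isIsotropicComplement_twistedComplement (t : ⋀[ℝ]^2 (GroupLieAlgebra 𝓘(ℝ, E) G)) :
    IsIsotropicComplement E (twistedComplement E t) := by
  refine ⟨fun x hx y hy => ?_, ?_, ?_⟩
  · rw [mem_twistedComplement_iff] at hx hy
    have h : toForm E G x.2 y.1 + toForm E G y.2 x.1 = 0 := by
      rw [hx, hy, apply_sharp, apply_sharp, bivectorForm_swap, neg_add_cancel]
    exact h
  · rw [Submodule.disjoint_def]
    intro x hx hxt
    have h2 : x.2 = 0 := hx.2
    rw [mem_twistedComplement_iff, h2, map_zero, map_zero] at hxt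
    exact Prod.ext hxt h2
  · rw [codisjoint_iff, eq_top_iff]
    intro x _
    refine Submodule.mem_sup.2 ⟨(x.1 - sharp t (toForm E G x.2), 0), ⟨trivial, rfl⟩,
      (sharp t (toForm E G x.2), x.2), mem_twistedComplement_iff.2 rfl, ?_⟩
    exact Prod.ext (sub_add_cancel _ _) (zero_add _)

variable [LieGroup 𝓘(ℝ, E) ∞ G] [FiniteDimensional ℝ E] [CompleteSpace E]

/-- If `t` is supported on an abelian subspace `A`, the infinitesimal dressing action
`ξ ↦ ξ - η ∘ ad (t♯ξ)` of `𝔤*_t` is injective: an element `ξ` of the kernel vanishes on `A`, because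
`t♯ξ` lies in `A`; but `t♯ξ` only depends on the restriction of `ξ` to `A`. -/
lemma isAdmissibleAt_twistedComplement {A : Submodule ℝ (GroupLieAlgebra 𝓘(ℝ, E) G)}
    (hA : ∀ x ∈ A, ∀ y ∈ A, ⁅x, y⁆ = 0)
    (ht : t ∈ LinearMap.range (exteriorPower.map 2 A.subtype)) (η : CoLie E) :
    IsAdmissibleAt E (twistedComplement E t) η := by
  let φ : CoLie E →ₗ[ℝ] CoLie E :=
    { toFun := fun ξ => infDressing E η ((sharp t (toForm E G ξ), ξ) : Double E G)
      map_add' := fun ξ ζ => by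
        rw [map_add, map_add]
        exact map_add (mfderiv (𝓘(ℝ, E).prod 𝓘(ℝ, CoLie E)) 𝓘(ℝ, CoLie E)
          (fun d : CotangentGroup E G => d • η) 1) (sharp t (toForm E G ξ), ξ)
            (sharp t (toForm E G ζ), ζ)
      map_smul' := fun r ξ => by
        rw [map_smul, map_smul]
        exact map_smul (mfderiv (𝓘(ℝ, E).prod 𝓘(ℝ, CoLie E)) 𝓘(ℝ, CoLie E)
          (fun d : CotangentGroup E G => d • η) 1) r (sharp t (toForm E G ξ), ξ) }
  have hφ : ∀ ξ, φ ξ = infDressing E η ((sharp t (toForm E G ξ), ξ) : Double E G) := fun _ => rfl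
  have hinj : Function.Injective φ := by
    rw [← LinearMap.ker_eq_bot, LinearMap.ker_eq_bot']
    intro ξ hξ
    have h1 : ∀ Z : GroupLieAlgebra 𝓘(ℝ, E) G,
        toForm E G ξ Z = toForm E G η ⁅sharp t (toForm E G ξ), Z⁆ := fun Z => by
      have h := infDressing_apply η ((sharp t (toForm E G ξ), ξ) : Double E G) Z
      rw [← hφ, hξ] at h
      exact sub_eq_zero.1 h.symm
    have h2 : sharp t (toForm E G ξ) = 0 := sharp_eq_zero ht fun Z hZ => by
      rw [h1, hA _ (sharp_mem ht _) Z hZ, map_zero]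
    have h4 : ∀ Z : GroupLieAlgebra 𝓘(ℝ, E) G, toForm E G ξ Z = 0 := fun Z => by
      rw [h1, h2, zero_lie, map_zero]
    exact ContinuousLinearMap.ext h4
  have hbij : Function.Bijective φ := ⟨hinj, LinearMap.injective_iff_surjective.1 hinj⟩
  have hsnd : Function.Bijective fun x : twistedComplement E t => (x : Double E G).2 := by
    refine ⟨fun x y h => ?_, fun ξ =>
      ⟨⟨(sharp t (toForm E G ξ), ξ), mem_twistedComplement_iff.2 rfl⟩, rfl⟩⟩
    refine Subtype.ext (Prod.ext ?_ h)
    rw [mem_twistedComplement_iff.1 x.2, mem_twistedComplement_iff.1 y.2]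
    exact congrArg (fun ξ => sharp t (toForm E G ξ)) h
  have hc : (fun x : twistedComplement E t => infDressing E η (x : Double E G))
      = φ ∘ fun x : twistedComplement E t => (x : Double E G).2 := by
    funext x
    rw [Function.comp_apply, hφ, ← mem_twistedComplement_iff.1 x.2]
  rw [IsAdmissibleAt, hc]
  exact hbij.comp hsnd

theorem isCompleteTriple_twistedComplement {A : Submodule ℝ (GroupLieAlgebra 𝓘(ℝ, E) G)}
    (hA : ∀ x ∈ A, ∀ y ∈ A, ⁅x, y⁆ = 0)
    (ht : t ∈ LinearMap.range (exteriorPower.map 2 A.subtype)) :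
    IsCompleteTriple E (twistedComplement E t) :=
  ⟨isIsotropicComplement_twistedComplement t, isAdmissibleAt_twistedComplement hA ht⟩

end CompleteTriple

/-! ### Pullbacks of constant bilinear forms -/

section Pullback

variable {F : Type*} [NormedAddCommGroup F] [NormedSpace ℝ F]
  {M : Type*} [TopologicalSpace M] [ChartedSpace F M]
  {N : Type*} [NormedAddCommGroup N] [NormedSpace ℝ N]

lemma swap_of_self {T : N →L[ℝ] N →L[ℝ] ℝ} (hT : ∀ x, T x x = 0) (x y : N) :
    T x y = -T y x := by
  have h := hT (x + y)
  simp only [map_add, add_apply, hT, zero_add, add_zero] at h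
  linarith

/-- The pullback `f^*T` of a bilinear form `T` on a vector space `N`, regarded as a field of
bilinear forms with constant coefficients, under `f : M → N`. -/
def pullbackForm (T : N →L[ℝ] N →L[ℝ] ℝ) (f : M → N) (p : M) :
    TangentSpace 𝓘(ℝ, F) p →L[ℝ] TangentSpace 𝓘(ℝ, F) p →L[ℝ] ℝ :=
  ContinuousLinearMap.bilinearComp (E' := F) (F' := F) T (mvfderiv 𝓘(ℝ, F) f p)
    (mvfderiv 𝓘(ℝ, F) f p)

lemma pullbackForm_apply (T : N →L[ℝ] N →L[ℝ] ℝ) (f : M → N) (p : M)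
    (u v : TangentSpace 𝓘(ℝ, F) p) :
    pullbackForm T f p u v = T (mvfderiv 𝓘(ℝ, F) f p u) (mvfderiv 𝓘(ℝ, F) f p v) := rfl

lemma pullbackForm_swap {T : N →L[ℝ] N →L[ℝ] ℝ} (hT : ∀ x, T x x = 0) (f : M → N) (p : M)
    (u v : TangentSpace 𝓘(ℝ, F) p) : pullbackForm T f p u v = -pullbackForm T f p v u :=
  swap_of_self hT _ _

lemma contDiff_flip : ContDiff ℝ ∞ fun L : F →L[ℝ] N →L[ℝ] ℝ => L.flip := by
  refine IsBoundedLinearMap.contDiff (IsLinearMap.with_bound ⟨fun _ _ => rfl, fun _ _ => rfl⟩ 1 ?_)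
  intro L
  rw [ContinuousLinearMap.opNorm_flip, one_mul]
lemma contDiff_bilinearComp_self (T : N →L[ℝ] N →L[ℝ] ℝ) :
    ContDiff ℝ ∞ fun D : F →L[ℝ] N => T.bilinearComp D D := by
  have h1 : ContDiff ℝ ∞ fun D : F →L[ℝ] N => T.comp D := contDiff_const.clm_comp contDiff_id
  have h3 : ContDiff ℝ ∞ fun D : F →L[ℝ] N => (T.comp D).flip := contDiff_flip.comp h1
  have h4 : ContDiff ℝ ∞ fun D : F →L[ℝ] N => (T.comp D).flip.comp D := h3.clm_comp contDiff_id
  exact contDiff_flip.comp h4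

variable [IsManifold 𝓘(ℝ, F) ∞ M]

lemma contMDiff_pullbackForm (T : N →L[ℝ] N →L[ℝ] ℝ) {f : M → N}
    (hf : ContMDiff 𝓘(ℝ, F) 𝓘(ℝ, N) ∞ f) :
    ContMDiff 𝓘(ℝ, F) (𝓘(ℝ, F).prod 𝓘(ℝ, F →L[ℝ] F →L[ℝ] ℝ)) ∞
    (fun p => Bundle.TotalSpace.mk' (F →L[ℝ] F →L[ℝ] ℝ)
      (E := fun p : M => TangentSpace 𝓘(ℝ, F) p →L[ℝ] TangentSpace 𝓘(ℝ, F) p →L[ℝ] ℝ)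
      p (pullbackForm T f p)) := by
  intro p
  rw [contMDiffAt_form_iff]
  have h1 : ContMDiffAt 𝓘(ℝ, F →L[ℝ] N) 𝓘(ℝ, F →L[ℝ] F →L[ℝ] ℝ) ∞
      (fun D : F →L[ℝ] N => T.bilinearComp D D)
      ((mvfderiv 𝓘(ℝ, F) f p).comp (frame p p) : F →L[ℝ] N) :=
    (contDiff_bilinearComp_self T).contMDiff.contMDiffAt
  have h2 := h1.comp p (contMDiffAt_mvfderiv_frame hf p)
  have h3 : (fun q => formInFrame p q (pullbackForm T f q))
      = (fun D : F →L[ℝ] N => T.bilinearComp D D) ∘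
        fun q => ((mvfderiv 𝓘(ℝ, F) f q).comp (frame p q) : F →L[ℝ] N) := by
    funext q
    exact ContinuousLinearMap.ext fun u => ContinuousLinearMap.ext fun v => rfl
  rw [h3]
  exact h2

lemma mvfderiv_bilinear (T : N →L[ℝ] N →L[ℝ] ℝ) {a b : M → N} {p : M}
    (ha : MDifferentiableAt 𝓘(ℝ, F) 𝓘(ℝ, N) a p) (hb : MDifferentiableAt 𝓘(ℝ, F) 𝓘(ℝ, N) b p)
    (u : TangentSpace 𝓘(ℝ, F) p) :
    mvfderiv 𝓘(ℝ, F) (fun q => T (a q) (b q)) p u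
      = T (a p) (mvfderiv 𝓘(ℝ, F) b p u) + T (mvfderiv 𝓘(ℝ, F) a p u) (b p) := by
  have hI : IsManifold 𝓘(ℝ, F) 1 M := IsManifold.of_le (n := ∞) (by simp)
  have hp := mem_extChartAt_target (I := 𝓘(ℝ, F)) p
  have ha' := (comp_extChartAt_symm_differentiableAt hp (by rwa [extChartAt_to_inv])).hasFDerivAt
    (f := a ∘ (extChartAt 𝓘(ℝ, F) p).symm)
  have hb' := (comp_extChartAt_symm_differentiableAt hp (by rwa [extChartAt_to_inv])).hasFDerivAt
    (f := b ∘ (extChartAt 𝓘(ℝ, F) p).symm)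
  have h := T.hasFDerivAt_of_bilinear ha' hb'
  have hT : MDifferentiableAt 𝓘(ℝ, F) 𝓘(ℝ, ℝ) (fun q => T (a q) (b q)) p :=
    MDifferentiableAt.comp (I' := 𝓘(ℝ, N × N)) (g := fun z : N × N => T z.1 z.2)
      (f := fun q => (a q, b q)) p
      (T.isBoundedBilinearMap.hasFDerivAt (a p, b p)).differentiableAt.mdifferentiableAt
      (ha.prodMk_space hb)
  rw [mvfderiv_eq_fderiv_self hT, mvfderiv_eq_fderiv_self ha, mvfderiv_eq_fderiv_self hb]
  refine (congrArg (fun L : F →L[ℝ] ℝ => L u) h.fderiv).trans ?_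
  simp only [Function.comp_apply, extChartAt_to_inv]
  rfl

/-- The pullback of a constant alternating form is closed: the second derivatives of `f` cancel,
because the derivative of `f` along `[U, V]` is the commutator of those along `U` and `V`. -/
lemma dTwoForm_pullbackForm [CompleteSpace F] {T : N →L[ℝ] N →L[ℝ] ℝ} (hT : ∀ x, T x x = 0)
    {f : M → N} (hf : ContMDiff 𝓘(ℝ, F) 𝓘(ℝ, N) ∞ f) {U V W : Π p : M, TangentSpace 𝓘(ℝ, F) p}
    (hU : SmoothField U) (hV : SmoothField V) (hW : SmoothField W) (p : M) :
    dTwoForm (pullbackForm T f) U V W p = 0 := by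
  have hd : ∀ {U : Π p : M, TangentSpace 𝓘(ℝ, F) p}, SmoothField U →
      MDifferentiableAt 𝓘(ℝ, F) 𝓘(ℝ, N) (fun q => mvfderiv 𝓘(ℝ, F) f q (U q)) p :=
    fun hU => (contMDiff_mvfderiv_apply hf hU).mdifferentiable (by simp) p
  have hbr : ∀ {U V : Π p : M, TangentSpace 𝓘(ℝ, F) p}, SmoothField U → SmoothField V → _ :=
    fun {U V} hU hV => mvfderiv_mlieBracket (N := N) hf (hU.mdifferentiableAt p)
      (hV.mdifferentiableAt p) (hd hU) (hd hV)
  simp only [dTwoForm, pullbackForm_apply]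
  rw [mvfderiv_bilinear T (hd hV) (hd hW), mvfderiv_bilinear T (hd hU) (hd hW),
    mvfderiv_bilinear T (hd hU) (hd hV), hbr hU hV, hbr hU hW, hbr hV hW]
  simp only [map_sub, sub_apply]
  rw [swap_of_self hT _ (mvfderiv 𝓘(ℝ, F) f p (U p)),
    swap_of_self hT _ (mvfderiv 𝓘(ℝ, F) f p (U p)),
    swap_of_self hT _ (mvfderiv 𝓘(ℝ, F) f p (V p)),
    swap_of_self hT _ (mvfderiv 𝓘(ℝ, F) f p (V p))]
  ring

lemma contMDiff_form_sub
    {B B' : Π q : M, TangentSpace 𝓘(ℝ, F) q →L[ℝ] TangentSpace 𝓘(ℝ, F) q →L[ℝ] ℝ}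
    (hB : ContMDiff 𝓘(ℝ, F) (𝓘(ℝ, F).prod 𝓘(ℝ, F →L[ℝ] F →L[ℝ] ℝ)) ∞
      (fun p => Bundle.TotalSpace.mk' (F →L[ℝ] F →L[ℝ] ℝ)
      (E := fun p : M => TangentSpace 𝓘(ℝ, F) p →L[ℝ] TangentSpace 𝓘(ℝ, F) p →L[ℝ] ℝ)
      p (B p)))
    (hB' : ContMDiff 𝓘(ℝ, F) (𝓘(ℝ, F).prod 𝓘(ℝ, F →L[ℝ] F →L[ℝ] ℝ)) ∞
      (fun p => Bundle.TotalSpace.mk' (F →L[ℝ] F →L[ℝ] ℝ)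
      (E := fun p : M => TangentSpace 𝓘(ℝ, F) p →L[ℝ] TangentSpace 𝓘(ℝ, F) p →L[ℝ] ℝ)
      p (B' p))) :
    ContMDiff 𝓘(ℝ, F) (𝓘(ℝ, F).prod 𝓘(ℝ, F →L[ℝ] F →L[ℝ] ℝ)) ∞
      (fun p => Bundle.TotalSpace.mk' (F →L[ℝ] F →L[ℝ] ℝ)
      (E := fun p : M => TangentSpace 𝓘(ℝ, F) p →L[ℝ] TangentSpace 𝓘(ℝ, F) p →L[ℝ] ℝ)
      p (B p - B' p)) := by
  intro p
  rw [contMDiffAt_form_iff]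
  have h := ((contMDiffAt_form_iff B p).1 (hB p)).sub ((contMDiffAt_form_iff B' p).1 (hB' p))
  have h' : (fun q => formInFrame p q (B q - B' q))
      = (fun q => formInFrame p q (B q)) - fun q => formInFrame p q (B' q) := by
    funext q
    exact ContinuousLinearMap.ext fun u => ContinuousLinearMap.ext fun v => rfl
  rw [h']
  exact h

lemma dTwoForm_sub {B B' : Π q : M, TangentSpace 𝓘(ℝ, F) q →L[ℝ] TangentSpace 𝓘(ℝ, F) q →L[ℝ] ℝ}
    (hB : ContMDiff 𝓘(ℝ, F) (𝓘(ℝ, F).prod 𝓘(ℝ, F →L[ℝ] F →L[ℝ] ℝ)) ∞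
      (fun p => Bundle.TotalSpace.mk' (F →L[ℝ] F →L[ℝ] ℝ)
      (E := fun p : M => TangentSpace 𝓘(ℝ, F) p →L[ℝ] TangentSpace 𝓘(ℝ, F) p →L[ℝ] ℝ)
      p (B p)))
    (hB' : ContMDiff 𝓘(ℝ, F) (𝓘(ℝ, F).prod 𝓘(ℝ, F →L[ℝ] F →L[ℝ] ℝ)) ∞
      (fun p => Bundle.TotalSpace.mk' (F →L[ℝ] F →L[ℝ] ℝ)
      (E := fun p : M => TangentSpace 𝓘(ℝ, F) p →L[ℝ] TangentSpace 𝓘(ℝ, F) p →L[ℝ] ℝ)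
      p (B' p)))
    {U V W : Π p : M, TangentSpace 𝓘(ℝ, F) p}
    (hU : SmoothField U) (hV : SmoothField V) (hW : SmoothField W) (p : M) :
    dTwoForm (fun q => B q - B' q) U V W p = dTwoForm B U V W p - dTwoForm B' U V W p := by
  have h : ∀ {U V : Π p : M, TangentSpace 𝓘(ℝ, F) p}, SmoothField U → SmoothField V →
      ∀ w : TangentSpace 𝓘(ℝ, F) p,
      mvfderiv 𝓘(ℝ, F) (fun q => B q (U q) (V q) - B' q (U q) (V q)) p w
        = mvfderiv 𝓘(ℝ, F) (fun q => B q (U q) (V q)) p w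
          - mvfderiv 𝓘(ℝ, F) (fun q => B' q (U q) (V q)) p w := fun hU hV w => by
    have h1 := (contMDiff_form_apply hB hU hV).mdifferentiable (by simp) p
    have h2 := (contMDiff_form_apply hB' hU hV).mdifferentiable (by simp) p
    exact congrArg (fun L : F →L[ℝ] ℝ => L w) (h1.hasMFDerivAt.sub h2.hasMFDerivAt).mfderiv
  simp only [dTwoForm, sub_apply]
  rw [h hV hW, h hU hW, h hU hV]
  ring

end Pullback

/-! ### The deformed symplectic form -/

section Deformation

variable {E : Type*} [NormedAddCommGroup E] [NormedSpace ℝ E]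
  {G : Type*} [TopologicalSpace G] [ChartedSpace E G] [Group G]

/-- A bivector `t ∈ Λ² 𝔤` as a continuous bilinear form on `𝔤*`. -/
def momentTwist [FiniteDimensional ℝ E] (t : ⋀[ℝ]^2 (GroupLieAlgebra 𝓘(ℝ, E) G)) :
    CoLie E →L[ℝ] CoLie E →L[ℝ] ℝ :=
  LinearMap.toContinuousBilinearMap
    ((bivectorForm t).compl₁₂ (toForm E G) (toForm E G) : CoLie E →ₗ[ℝ] CoLie E →ₗ[ℝ] ℝ)

lemma momentTwist_apply [FiniteDimensional ℝ E]
    (t : ⋀[ℝ]^2 (GroupLieAlgebra 𝓘(ℝ, E) G)) (ξ η : CoLie E) :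
    momentTwist t ξ η = toForm E G η (sharp t (toForm E G ξ)) :=
  (apply_sharp _ _ _).symm

lemma momentTwist_self [FiniteDimensional ℝ E]
    (t : ⋀[ℝ]^2 (GroupLieAlgebra 𝓘(ℝ, E) G)) (ξ : CoLie E) :
    momentTwist t ξ ξ = 0 := bivectorForm_self t _

variable {F : Type*} [NormedAddCommGroup F] [NormedSpace ℝ F]
  {M : Type*} [TopologicalSpace M] [ChartedSpace F M] [IsManifold 𝓘(ℝ, F) ∞ M] [MulAction G M]

namespace IsHamiltonianAction

variable {Ω : SymplecticForm F M} {μ : M → CoLie E}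

/-- The moment map condition, in terms of the derivative of the vector-valued map `μ`. -/
lemma toForm_mvfderiv (hμ : IsHamiltonianAction (G := G) Ω μ) (p : M)
    (v : TangentSpace 𝓘(ℝ, F) p) (X : GroupLieAlgebra 𝓘(ℝ, E) G) :
    toForm E G (mvfderiv 𝓘(ℝ, F) μ p v) X = Ω.form p (fundamental E G F p X) v := by
  rw [← hμ.moment]
  have hd : MDifferentiableAt 𝓘(ℝ, F) 𝓘(ℝ, CoLie E) μ p :=
    hμ.smooth_moment.mdifferentiable (by simp) p
  have h : ∀ x : E, mfderiv 𝓘(ℝ, F) 𝓘(ℝ, ℝ) (fun q => μ q x) p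
      = (ContinuousLinearMap.apply ℝ ℝ x).comp
        (mfderiv 𝓘(ℝ, F) 𝓘(ℝ, CoLie E) μ p : F →L[ℝ] CoLie E) := fun x =>
    (((ContinuousLinearMap.apply ℝ ℝ x).hasFDerivAt (x := μ p)).hasMFDerivAt.comp p
      hd.hasMFDerivAt).mfderiv
  exact (congrArg (fun L : F →L[ℝ] ℝ => L v) (h X)).symm

/-- By equivariance of the moment map, `Ω(X_M, Y_M)` is given by `μ` and the Lie bracket. -/
lemma form_fundamental [LieGroup 𝓘(ℝ, E) ∞ G] [CompleteSpace E]
    (hμ : IsHamiltonianAction (G := G) Ω μ) (p : M)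
    (X Y : GroupLieAlgebra 𝓘(ℝ, E) G) :
    Ω.form p (fundamental E G F p X) (fundamental E G F p Y) = -toForm E G (μ p) ⁅Y, X⁆ := by
  rw [← hμ.toForm_mvfderiv]
  obtain ⟨L, hL, hd⟩ := exists_hasMFDerivAt_coAd (E := E) (G := G) (μ p)
  have hs : MDifferentiableAt 𝓘(ℝ, E) 𝓘(ℝ, F) (fun g : G => g • p) 1 := by
    have h : ContMDiff 𝓘(ℝ, E) 𝓘(ℝ, F) ∞ (fun g : G => g • p) :=
      hμ.smooth_action.comp (contMDiff_id.prodMk contMDiff_const)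
    exact h.mdifferentiable (by simp) 1
  have hm : MDifferentiableAt 𝓘(ℝ, F) 𝓘(ℝ, CoLie E) μ ((1 : G) • p) :=
    hμ.smooth_moment.mdifferentiable (by simp) _
  have h1 := hm.hasMFDerivAt.comp (1 : G) hs.hasMFDerivAt
  have he : (μ ∘ fun g : G => g • p) = fun g : G => coAd E g (μ p) := by
    funext g
    exact hμ.equivariant g p
  rw [he] at h1
  have h2 := hasMFDerivAt_unique h1 hd
  -- `1 • p = p` is not a definitional equality
  have h3 : ∀ q : M, q = p → ∀ v : F,
      (mfderiv 𝓘(ℝ, F) 𝓘(ℝ, CoLie E) μ q : F →L[ℝ] CoLie E) v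
        = (mfderiv 𝓘(ℝ, F) 𝓘(ℝ, CoLie E) μ p : F →L[ℝ] CoLie E) v := by
    rintro _ rfl v; rfl
  have h4 : (mvfderiv 𝓘(ℝ, F) μ p (fundamental E G F p Y) : CoLie E) = L Y :=
    (h3 _ (one_smul G p) _).symm.trans (congrArg (fun T : E →L[ℝ] CoLie E => T Y) h2)
  rw [h4]
  exact hL Y X

variable [LieGroup 𝓘(ℝ, E) ∞ G] [CompleteSpace E]
  [FiniteDimensional ℝ E]
  {A : Submodule ℝ (GroupLieAlgebra 𝓘(ℝ, E) G)} {t : ⋀[ℝ]^2 (GroupLieAlgebra 𝓘(ℝ, E) G)}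

/-- The endomorphism `C v = v + (t♯ dμ(v))_M` of the tangent bundle satisfies
`ω_t(C v, u) = ω(v, u)`, where `ω_t = ω - t(dμ, dμ)`. The term of second order in `t` vanishes: it
is given by `ω(X_M, Y_M)` with `X`, `Y` in an abelian subalgebra. -/
lemma form_sub_pullbackForm_twist (hμ : IsHamiltonianAction (G := G) Ω μ)
    (hA : ∀ x ∈ A, ∀ y ∈ A, ⁅x, y⁆ = 0)
    (ht : t ∈ LinearMap.range (exteriorPower.map 2 A.subtype)) (p : M)
    (v u : TangentSpace 𝓘(ℝ, F) p) :
    Ω.form p (v + fundamental E G F p (sharp t (toForm E G (mvfderiv 𝓘(ℝ, F) μ p v)))) u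
      - pullbackForm (momentTwist t) μ p
        (v + fundamental E G F p (sharp t (toForm E G (mvfderiv 𝓘(ℝ, F) μ p v)))) u
      = Ω.form p v u := by
  set Y := sharp t (toForm E G (mvfderiv 𝓘(ℝ, F) μ p v)) with hY
  have h : sharp t (toForm E G (mvfderiv 𝓘(ℝ, F) μ p (fundamental E G F p Y))) = 0 := by
    refine sharp_eq_zero ht fun X hX => ?_
    rw [hμ.toForm_mvfderiv, hμ.form_fundamental, hA _ (sharp_mem ht _) X hX, map_zero, neg_zero]
  rw [pullbackForm_apply, momentTwist_apply, map_add, map_add, map_add,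
    map_add, h, add_zero, ← hY, hμ.toForm_mvfderiv, add_apply, add_sub_cancel_right]

variable [FiniteDimensional ℝ F]

/-- The deformed symplectic form `ω_t = ω - t(dμ, dμ)`. -/
def twistedForm (hμ : IsHamiltonianAction (G := G) Ω μ)
    (hA : ∀ x ∈ A, ∀ y ∈ A, ⁅x, y⁆ = 0)
    (ht : t ∈ LinearMap.range (exteriorPower.map 2 A.subtype)) : SymplecticForm F M where
  form p := Ω.form p - pullbackForm (momentTwist t) μ p
  alt p u := by
    have h : Ω.form p u u - pullbackForm (momentTwist t) μ p u u = 0 := by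
      rw [Ω.alt, pullbackForm_apply, momentTwist_self, sub_zero]
    exact h
  smooth := contMDiff_form_sub Ω.smooth (contMDiff_pullbackForm (momentTwist t) hμ.smooth_moment)
  closed U V W hU hV hW p := by
    rw [dTwoForm_sub Ω.smooth (contMDiff_pullbackForm (momentTwist t) hμ.smooth_moment) hU hV hW,
      Ω.closed U V W hU hV hW, dTwoForm_pullbackForm (momentTwist_self t) hμ.smooth_moment hU hV hW,
      sub_zero]
  nondeg p u hu := by
    -- `ω(v, u) = ω_t(C v, u) = 0`, where `C v = v + (t♯ dμ(v))_M`
    refine Ω.nondeg p u fun v => ?_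
    have h : Ω.form p u _ - pullbackForm (momentTwist t) μ p u _ = 0 :=
      hu (v + fundamental E G F p (sharp t (toForm E G (mvfderiv 𝓘(ℝ, F) μ p v))))
    rw [Ω.form_swap, ← hμ.form_sub_pullbackForm_twist hA ht p v u, ← h, Ω.form_swap p u,
      pullbackForm_swap (momentTwist_self t) μ p u]
    ring

/-- The Poisson structure induced by `ω_t` is `π - t_M`: the vector dual to `ι_v ω` with respect to
`ω_t` is `v + (t♯ dμ(v))_M`, and the restriction of `ι_v ω` to the orbit directions is `-dμ(v)`. -/
lemma poisson_twistedForm (hμ : IsHamiltonianAction (G := G) Ω μ)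
    (hA : ∀ x ∈ A, ∀ y ∈ A, ⁅x, y⁆ = 0)
    (ht : t ∈ LinearMap.range (exteriorPower.map 2 A.subtype)) :
    (hμ.twistedForm hA ht).poisson = twistedPoisson Ω t := by
  funext p
  refine LinearMap.ext fun α => LinearMap.ext fun β => ?_
  obtain ⟨v, rfl⟩ := (Ω.flat p).surjective α
  have h1 : ((hμ.twistedForm hA ht).flat p).symm (Ω.flat p v)
      = v + fundamental E G F p (sharp t (toForm E G (mvfderiv 𝓘(ℝ, F) μ p v))) := by
    rw [LinearEquiv.symm_apply_eq]
    exact LinearMap.ext fun u => (hμ.form_sub_pullbackForm_twist hA ht p v u).symm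
  have h2 : Ω.flat p v ∘ₗ (fundamental E G F p).toLinearMap
      = -toForm E G (mvfderiv 𝓘(ℝ, F) μ p v) := LinearMap.ext fun X => by
    rw [LinearMap.neg_apply, hμ.toForm_mvfderiv, ← Ω.form_swap]; rfl
  have h3 : fundamentalBivector t p (Ω.flat p v) β
      = -β (fundamental E G F p (sharp t (toForm E G (mvfderiv 𝓘(ℝ, F) μ p v)))) := by
    rw [fundamentalBivector, bivectorForm_map, h2, ← apply_sharp, map_neg, map_neg]; rfl
  rw [SymplecticForm.poisson_apply, h1, map_add, twistedPoisson, LinearMap.sub_apply,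
    LinearMap.sub_apply, h3, SymplecticForm.poisson_apply, LinearEquiv.symm_apply_apply,
    sub_neg_eq_add]

theorem deformsSymplectic (hμ : IsHamiltonianAction (G := G) Ω μ)
    (hA : ∀ x ∈ A, ∀ y ∈ A, ⁅x, y⁆ = 0)
    (ht : t ∈ LinearMap.range (exteriorPower.map 2 A.subtype)) :
    DeformsSymplectic Ω t := by
  rw [DeformsSymplectic, ← hμ.poisson_twistedForm hA ht]
  exact ⟨SymplecticForm.isPoisson_poisson _, SymplecticForm.poisson_nondegenerate _, _, rfl,
    fun _ h => SymplecticForm.poisson_injective h⟩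

end IsHamiltonianAction

end Deformation

/-! ### The span of two commuting elements -/

section AbelianSupport

lemma lie_eq_zero_of_mem_span_pair {L : Type*} [LieRing L] [LieAlgebra ℝ L] {X Y : L}
    (h : ⁅X, Y⁆ = 0) : ∀ x ∈ Submodule.span ℝ {X, Y}, ∀ y ∈ Submodule.span ℝ {X, Y},
      ⁅x, y⁆ = 0 := by
  intro x hx y hy
  obtain ⟨a, b, rfl⟩ := Submodule.mem_span_pair.1 hx
  obtain ⟨c, d, rfl⟩ := Submodule.mem_span_pair.1 hy
  have h' : ⁅Y, X⁆ = 0 := by rw [← lie_skew, h, neg_zero]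
  simp [h, h']

lemma smul_wedge₂_mem_range {V : Type*} [AddCommGroup V] [Module ℝ V] {A : Submodule ℝ V}
    {v w : V} (hv : v ∈ A) (hw : w ∈ A) (r : ℝ) :
    r • wedge₂ v w ∈ LinearMap.range (exteriorPower.map 2 A.subtype) :=
  ⟨r • wedge₂ ⟨v, hv⟩ ⟨w, hw⟩, by rw [map_smul, map_wedge₂]; rfl⟩

end AbelianSupport

end SympTwist

theorem mainTheorem2 {n m : ℕ}
    {G : Type*} [TopologicalSpace G] [ChartedSpace (EuclideanSpace ℝ (Fin n)) G] [Group G]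
    [LieGroup 𝓘(ℝ, EuclideanSpace ℝ (Fin n)) ∞ G] [ConnectedSpace G]
    {M : Type*} [TopologicalSpace M] [T2Space M] [ChartedSpace (EuclideanSpace ℝ (Fin m)) M]
    [IsManifold 𝓘(ℝ, EuclideanSpace ℝ (Fin m)) ∞ M] [MulAction G M]
    (Ω : SympTwist.SymplecticForm (EuclideanSpace ℝ (Fin m)) M)
    (μ : M → SympTwist.CoLie (EuclideanSpace ℝ (Fin n)))
    (hμ : SympTwist.IsHamiltonianAction (G := G) Ω μ) :
    (∀ X Y : GroupLieAlgebra 𝓘(ℝ, EuclideanSpace ℝ (Fin n)) G, ⁅X, Y⁆ = 0 →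
      ∀ t, t = (1 / 2 : ℝ) • SympTwist.wedge₂ X Y →
        SympTwist.schouten t t = 0 ∧
        SympTwist.IsCompleteTriple _ (SympTwist.twistedComplement _ t) ∧
        SympTwist.DeformsSymplectic Ω t) ∧
    (∀ 𝔥 : LieSubalgebra ℝ (GroupLieAlgebra 𝓘(ℝ, EuclideanSpace ℝ (Fin n)) G),
      𝔥.IsCartanSubalgebra →
        (SympTwist.IsReductive (GroupLieAlgebra 𝓘(ℝ, EuclideanSpace ℝ (Fin n)) G) →
          IsLieAbelian 𝔥) ∧
        (IsLieAbelian 𝔥 →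
          ∀ t ∈ LinearMap.range (exteriorPower.map 2 𝔥.toSubmodule.subtype),
            SympTwist.schouten t t = 0 ∧
            SympTwist.IsCompleteTriple _ (SympTwist.twistedComplement _ t) ∧
            SympTwist.DeformsSymplectic Ω t)) := by
  have key : ∀ (A : Submodule ℝ (GroupLieAlgebra 𝓘(ℝ, EuclideanSpace ℝ (Fin n)) G)),
      (∀ x ∈ A, ∀ y ∈ A, ⁅x, y⁆ = 0) →
      ∀ t ∈ LinearMap.range (exteriorPower.map 2 A.subtype),
        SympTwist.schouten t t = 0 ∧
        SympTwist.IsCompleteTriple _ (SympTwist.twistedComplement _ t) ∧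
        SympTwist.DeformsSymplectic Ω t := fun A hA t ht =>
    ⟨SympTwist.schouten_self_eq_zero hA ht, SympTwist.isCompleteTriple_twistedComplement hA ht,
      hμ.deformsSymplectic hA ht⟩
  refine ⟨fun X Y h t ht => ?_, fun 𝔥 h𝔥 => ⟨fun hr => ?_, fun hab => ?_⟩⟩
  · rw [ht]
    exact key _ (SympTwist.lie_eq_zero_of_mem_span_pair h) _ (SympTwist.smul_wedge₂_mem_range
      (Submodule.mem_span_of_mem (by simp)) (Submodule.mem_span_of_mem (by simp)) _)
  · have : FiniteDimensional ℝ (GroupLieAlgebra 𝓘(ℝ, EuclideanSpace ℝ (Fin n)) G) :=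
      inferInstanceAs (FiniteDimensional ℝ (EuclideanSpace ℝ (Fin n)))
    exact hr.isLieAbelian_of_isCartanSubalgebra 𝔥 h𝔥
  · refine key 𝔥.toSubmodule fun x hx y hy => ?_
    exact congrArg Subtype.val (trivial_lie_zero 𝔥 𝔥 ⟨x, hx⟩ ⟨y, hy⟩)
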